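/- Let $\beta>1$ be a non-simple Parry number: its Rényi expansion of unity $\mathrm d_\beta(1)=t_1t_2t_3\cdots$ (where $t_i=\lfloor\beta r_{i-1}\rfloor$, $r_0=1$, $r_i=\beta r_{i-1}-t_i$) is eventually periodic, $\mathrm d_\beta(1)=t_1\cdots t_m(t_{m+1}\cdots t_{m+p})^\omega$, with the positive integers $m,p$ least possible, and does not end in $0^\omega$. Let $\varphi_\beta$ be the canonical substitution on the alphabet $\{0,1,\dots,m+p-1\}$, $$\varphi_\beta(a)=0^{t_{a+1}}(a+1)\quad(0\le a<m+p-1),\qquad \varphi_\beta(m+p-1)=0^{t_{m+p}}m,$$ and let $\mathbf u_\beta=\lim_{n\to\infty}\varphi_\beta^n(0)$ be its fixed point. Put $t=\min\{t_m,t_{m+p}\}$ and $\triangle_m=\sum_{i\ge1}t_{i+m}\beta^{-i}$. For a finite word $w\ne\epsilon$ let $\mathrm{ind}(w)$ be the supremum of $|v|/|w|$ over the factors $v$ of $\mathbf u_\beta$ that are prefixes of $w^\omega$. The critical exponent $\mathrm E(\mathbf u_\beta)$ is the supremum of $\mathrm{ind}(w)$ over all nonempty factors $w$ of $\mathbf u_\beta$.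 The ultimate critical exponent is $\mathrm E^*(\mathbf u_\beta)=\limsup_{n\to\infty}\max\{\mathrm{ind}(w): w\text{ a factor of }\mathbf u_\beta,\ |w|=n\}$. Assume $t_1\ge3$. Then there is a letter $z\neq0$ such that the set of letters $a$ for which $a0^tm$ is a factor of $\mathbf u_\beta$ equals $\{0,z\}$ (so $z$ is unique). For $n=\ell m+k$ with $0\le k<m$, define $$z^{(n)}=\begin{cases}\epsilon & \text{if } n<m,\\ \varphi_\beta^{k}(0^tm)\,\varphi_\beta^{k+m}(0^tm)\cdots\varphi_\beta^{k+(\ell-1)m}(0^tm) & \text{if } n\ge m \text{ and } p\mid z,\\ \varphi_\beta^{n-m}(0^tm) & \text{otherwise.}\end{cases}$$ If $t_1\ge4$, or if $t_1=3$ and $p\nmid z$, then $$\mathrm E(\mathbf u_\beta)=\sup_{n\in\mathbb N}\left\{t_1+\frac{|z^{(n)}|+|\varphi_\beta^n(1)|-1}{|\varphi_\beta^n(0)|}\right\}$$ and $$\mathrm E^*(\mathbf u_\beta)=\begin{cases}\beta+\dfrac{1}{\beta^m-1}\,(t+\triangle_m) & \text{if } p\mid z,\\[2mm] \beta+\dfrac{1}{\beta^m}\,(t+\triangle_m)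 & \text{if } p\nmid z.\end{cases}$$ -/

import Mathlib

namespace ParryWord

/-! ### Combinatorics on words

Letters are natural numbers, finite words are lists of letters, infinite words are sequences. -/

/-- `w` is a factor of the infinite word `u`: it can be read in `u` from some position `i` on. -/
def IsFactor (u : ℕ → ℕ) (w : List ℕ) : Prop :=
  ∃ i : ℕ, w = (List.range w.length).map fun j => u (i + j)

/-- The set of left extensions of `w` in `u`. -/
def leftExt (u : ℕ → ℕ) (w : List ℕ) : Set ℕ :=
  {a | IsFactor u (a :: w)}

/-- `v` is a power of `w`, that is, a prefix of the periodic word `w w w ...`. -/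
def IsPowerOf (v w : List ℕ) : Prop :=
  ∃ k : ℕ, v <+: (List.replicate k w).flatten

/-- The index of `w` in `u`: the supremum of `|v| / |w|` over the factors `v` of `u` that are
powers of `w`. It is used for nonempty `w` only. -/
noncomputable def index (u : ℕ → ℕ) (w : List ℕ) : EReal :=
  sSup {e | ∃ v : List ℕ, IsFactor u v ∧ IsPowerOf v w ∧
    e = (((v.length : ℝ) / (w.length : ℝ) : ℝ) : EReal)}

/-- The critical exponent of `u`: the supremum of the indices of its nonempty factors. -/
noncomputable def criticalExponent (u : ℕ → ℕ) : EReal :=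
  sSup {e | ∃ w : List ℕ, w ≠ [] ∧ IsFactor u w ∧ e = index u w}

/-- The largest index of a factor of length `n` (there are finitely many of them). -/
noncomputable def indexOfLength (u : ℕ → ℕ) (n : ℕ) : EReal :=
  sSup {e | ∃ w : List ℕ, w.length = n ∧ IsFactor u w ∧ e = index u w}

/-- The ultimate critical exponent of `u`. -/
noncomputable def ultimateCriticalExponent (u : ℕ → ℕ) : EReal :=
  Filter.limsup (fun n => indexOfLength u n) Filter.atTop

/-! ### The Rényi expansion of unity -/

/-- The orbit of `1` under `x ↦ β x - ⌊β x⌋`. -/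
noncomputable def renyiRem (β : ℝ) : ℕ → ℝ
  | 0 => 1
  | n + 1 => Int.fract (β * renyiRem β n)

/-- The digit `t_i`, for `i ≥ 1`, of the Rényi expansion of unity `d_β(1) = t_1 t_2 t_3 ...`. -/
noncomputable def renyiDigit (β : ℝ) (i : ℕ) : ℕ :=
  ⌊β * renyiRem β (i - 1)⌋₊

/-- `t_1 t_2 t_3 ... = t_1 ... t_m (t_{m+1} ... t_{m+p})^ω`. -/
def IsEventuallyPeriodic (t : ℕ → ℕ) (m p : ℕ) : Prop :=
  ∀ i : ℕ, m < i → t (i + p) = t i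

/-- `β` is a non-simple Parry number with `d_β(1) = t_1 ... t_m (t_{m+1} ... t_{m+p})^ω`, where
the positive integers `m` and `p` are the least possible. -/
structure IsNonSimpleParry (β : ℝ) (m p : ℕ) : Prop where
  one_lt : 1 < β
  m_pos : 1 ≤ m
  p_pos : 1 ≤ p
  periodic : IsEventuallyPeriodic (renyiDigit β) m p
  least : ∀ m' p' : ℕ, 1 ≤ m' → 1 ≤ p' → IsEventuallyPeriodic (renyiDigit β) m' p' →
    m ≤ m' ∧ p ≤ p'
  /-- the expansion does not end in zeros only -/
  not_simple : ∀ n : ℕ, ∃ i : ℕ, n < i ∧ renyiDigit β i ≠ 0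

/-- `△_k = ∑_{i ≥ 1} t_{i+k} / β^i`. -/
noncomputable def gap (β : ℝ) (k : ℕ) : ℝ :=
  ∑' i : ℕ, (renyiDigit β (i + 1 + k) : ℝ) / β ^ (i + 1)

/-! ### The canonical substitution and its fixed point -/

/-- The image of a letter `a ∈ {0, ..., m+p-1}` under the canonical substitution: it is
`0^{t_{a+1}} (a+1)` for `a < m+p-1`, and `0^{t_{m+p}} m` for `a = m+p-1`. -/
def substLetter (t : ℕ → ℕ) (m p a : ℕ) : List ℕ :=
  List.replicate (t (a + 1)) 0 ++ [if a + 1 < m + p then a + 1 else m]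

/-- The canonical substitution on finite words. -/
def subst (t : ℕ → ℕ) (m p : ℕ) (w : List ℕ) : List ℕ :=
  w.flatMap (substLetter t m p)

/-- The `n`-th iterate of the canonical substitution. -/
def substIter (t : ℕ → ℕ) (m p n : ℕ) (w : List ℕ) : List ℕ :=
  (subst t m p)^[n] w

/-- The fixed point `lim φ^n(0)` of the canonical substitution `φ`. For `t_1 ≥ 1`, the words
`φ^n(0)` are prefixes of each other and `φ^n(0)` has more than `n` letters, so that the letter at
position `n` is that of `φ^n(0)`. -/
def fixedPoint (t : ℕ → ℕ) (m p : ℕ) : ℕ → ℕ :=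
  fun n => (substIter t m p n [0]).getD n 0

/-- The infinite word `u_β`. -/
noncomputable def uBeta (β : ℝ) (m p : ℕ) : ℕ → ℕ :=
  fixedPoint (renyiDigit β) m p

/-- `t = min {t_m, t_{m+p}}`. -/
def tMin (t : ℕ → ℕ) (m p : ℕ) : ℕ :=
  min (t m) (t (m + p))

/-- The word `0^t m`, where `t = min {t_m, t_{m+p}}`. -/
def zeroBlockM (t : ℕ → ℕ) (m p : ℕ) : List ℕ :=
  List.replicate (tMin t m p) 0 ++ [m]

/-- The word `z^{(n)}`: with `n = ℓ m + k`, `0 ≤ k < m`, it is empty if `n < m`, it is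
`φ^k(0^t m) φ^{k+m}(0^t m) ... φ^{k+(ℓ-1)m}(0^t m)` if `n ≥ m` and `p` divides `z`, and it is
`φ^{n-m}(0^t m)` otherwise. -/
def zWord (t : ℕ → ℕ) (m p z n : ℕ) : List ℕ :=
  if n < m then []
  else if p ∣ z then
    (List.range (n / m)).flatMap fun j => substIter t m p (n % m + j * m) (zeroBlockM t m p)
  else substIter t m p (n - m) (zeroBlockM t m p)

end ParryWord

namespace ParryWord

/-! A factor that is a power of `w` is a repetition of `u` with period `q = |w|`: a stretch of `B`
positions at which `u` agrees with its shift by `q`, of total length `B + q`. The proof classifies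
repetitions by desubstitution. Images of distinct letters already differ before the shorter one ends
(`exists_mismatch`), so a left-maximal repetition can be pulled back through as many powers of the
substitution as possible, down to a base word on whose right only zeros match
(`exists_desubstitution`).

If the base word contains a nonzero letter, the extension to the right is shorter than `q`. The
extension to the left is at most a common suffix of images of two distinct letters, hence at most
`2q`, and at most `q` if `p ∤ z`. So the exponent is below `4`, respectively `3`, and this is where
the assumption on `t_1` enters. If the base word is a power of `0`, the repetition is no longer than
the one that `φ^n` creates from a factor `p 0^{t_1} 1` (`repetition_bound_of_left_maximal`), and
that one does occur (`exists_repetition`). This gives the formula for `E`.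

The word `z^{(n)}` is the longest common suffix of `φ^n(0)` and `φ^n(p)`. Two images of letters end
in the same letter only when they come from `m-1` and `m+p-1`; they then share `0^t m`, preceded by
`0` in one and by `z` in the other, so the comparison restarts with the pair `0, z`
(`commonSuffix_spec`). Last letters advance by one modulo `p`, so this pair meets again, every `m`
steps, exactly when `p ∣ z`.

For `E*`, the normalised lengths `|φ^n(a)| / (β^n r_a)` evolve by averaging with state `0` and hence
tend to a common positive limit (`exists_tendsto_blockLen`). The exponents therefore converge, and
their limit equals the limsup over all lengths (`ultimateCriticalExponent_eq`). -/

/-- The last letter of the image of `a` under the canonical substitution. -/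
def nxt (m p a : ℕ) : ℕ := if a + 1 < m + p then a + 1 else m

/-- The length of the `n`-th image of the letter `a` under the canonical substitution. -/
def blockLen (t : ℕ → ℕ) (m p : ℕ) : ℕ → ℕ → ℕ
  | 0, _ => 1
  | n + 1, a => t (a + 1) * blockLen t m p n 0 + blockLen t m p n (nxt m p a)

/-- The data of a non-simple Parry number `β > 1` with `t_1 ≥ 3`: the digits `t`, the remainders
`r`, the fixed point `u` of the canonical substitution, and the positions `f x` in `u` at which
the image of the letter at position `x` starts. -/
structure ParrySystem (t : ℕ → ℕ) (m p : ℕ) (u f : ℕ → ℕ) (β : ℝ) (r : ℕ → ℝ) : Prop where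
  one_lt : 1 < β
  m_pos : 1 ≤ m
  p_pos : 1 ≤ p
  three_le : 3 ≤ t 1
  digit_ne : t m ≠ t (m + p)
  exists_digit_pos : ∃ i, m < i ∧ i ≤ m + p ∧ 0 < t i
  rem_zero : r 0 = 1
  rem_pos : ∀ a, 0 < r a
  rem_lt : ∀ a, 1 ≤ a → r a < 1
  rem_succ : ∀ a, β * r a = t (a + 1) + r (a + 1)
  rem_period : r (m + p) = r m
  u_zero : u 0 = 0
  f_zero : f 0 = 0
  f_succ : ∀ x, f (x + 1) = f x + t (u x + 1) + 1
  u_zeros : ∀ x j, j < t (u x + 1) → u (f x + j) = 0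
  u_last : ∀ x, u (f x + t (u x + 1)) = nxt m p (u x)

/-! ### Images of letters and of matching words -/

theorem nxt_ne_zero {m p : ℕ} (hm : 1 ≤ m) (a : ℕ) : nxt m p a ≠ 0 := by
  unfold nxt; split_ifs <;> omega

theorem nxt_lt {m p : ℕ} (hp : 1 ≤ p) (a : ℕ) : nxt m p a < m + p := by
  unfold nxt; split_ifs <;> omega

theorem eq_of_nxt_eq {m p a b : ℕ} (ha : a < m + p) (hb : b < m + p)
    (h : nxt m p a = nxt m p b) (hab : a ≠ b) :
    (a = m - 1 ∧ b = m + p - 1) ∨ (a = m + p - 1 ∧ b = m - 1) := by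
  unfold nxt at h; split_ifs at h <;> omega

theorem blockLen_pos (t : ℕ → ℕ) (m p n a : ℕ) : 0 < blockLen t m p n a := by
  induction n generalizing a with
  | zero => simp [blockLen]
  | succ n ih => simp only [blockLen]; have := ih (nxt m p a); omega

theorem blockLen_nxt_le (t : ℕ → ℕ) (m p n a : ℕ) :
    blockLen t m p n (nxt m p a) ≤ blockLen t m p (n + 1) a := by
  simp [blockLen]

namespace ParrySystem

variable {t : ℕ → ℕ} {m p : ℕ} {u f : ℕ → ℕ} {β : ℝ} {r : ℕ → ℝ}

/-- For `a ≥ 1`, `t (a + 1) < β * r a < β = t 1 + r 1 < t 1 + 1`. -/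
theorem digit_le (S : ParrySystem t m p u f β r) (a : ℕ) : t (a + 1) ≤ t 1 := by
  rcases Nat.eq_zero_or_pos a with rfl | ha
  · simp
  have h1 := S.rem_succ a
  have h0 := S.rem_succ 0
  have h2 := S.rem_lt a ha
  have h3 := S.rem_lt 1 le_rfl
  have h4 := S.rem_pos (a + 1)
  have h5 := S.one_lt
  rw [S.rem_zero] at h0
  have : (t (a + 1) : ℝ) < t 1 + 1 := by
    simp only [zero_add] at h0
    nlinarith
  have : t (a + 1) < t 1 + 1 := by exact_mod_cast this
  omega

theorem rem_le_one (S : ParrySystem t m p u f β r) (a : ℕ) : r a ≤ 1 := by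
  rcases Nat.eq_zero_or_pos a with rfl | ha
  · exact S.rem_zero.le
  · exact (S.rem_lt a ha).le

theorem rem_nxt (S : ParrySystem t m p u f β r) {a : ℕ} (ha : a < m + p) :
    β * r a = t (a + 1) + r (nxt m p a) := by
  unfold nxt
  split_ifs with h
  · exact S.rem_succ a
  · have : a + 1 = m + p := by omega
    rw [S.rem_succ a, this, S.rem_period]

theorem f_strictMono (S : ParrySystem t m p u f β r) : StrictMono f :=
  strictMono_nat_of_lt_succ fun x => by rw [S.f_succ]; omega

theorem exists_block (S : ParrySystem t m p u f β r) (y : ℕ) : ∃ x, f x ≤ y ∧ y < f (x + 1) := by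
  have hex : ∃ x, y < f x := ⟨y + 1, lt_of_lt_of_le (Nat.lt_succ_self y) (S.f_strictMono.le_apply)⟩
  classical
  have h1 := Nat.find_spec hex
  have h2 : Nat.find hex ≠ 0 := by
    intro h; rw [h, S.f_zero] at h1; omega
  obtain ⟨x, hx⟩ := Nat.exists_eq_succ_of_ne_zero h2
  refine ⟨x, ?_, by rw [hx] at h1; exact h1⟩
  have := Nat.find_min hex (m := x) (by omega)
  omega

/-- A nonzero letter ends the image of a letter. -/
theorem exists_of_ne_zero (S : ParrySystem t m p u f β r) {y : ℕ} (h : u y ≠ 0) :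
    ∃ x, y = f x + t (u x + 1) ∧ y + 1 = f (x + 1) ∧ u y = nxt m p (u x) := by
  obtain ⟨x, h1, h2⟩ := S.exists_block y
  rw [S.f_succ] at h2
  have h3 : ¬ (y - f x < t (u x + 1)) := fun hlt => h <| by
    have := S.u_zeros x _ hlt
    rwa [Nat.add_sub_cancel' h1] at this
  have h4 : y = f x + t (u x + 1) := by omega
  exact ⟨x, h4, by rw [S.f_succ]; omega, by rw [h4]; exact S.u_last x⟩

theorem u_lt (S : ParrySystem t m p u f β r) (y : ℕ) : u y < m + p := by
  by_cases h : u y = 0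
  · have := S.m_pos; omega
  · obtain ⟨x, -, -, h⟩ := S.exists_of_ne_zero h
    rw [h]; exact nxt_lt S.p_pos _

/-- A run of zeros followed by a nonzero letter lies in the image of a letter. -/
theorem exists_of_zero_run (S : ParrySystem t m p u f β r) {y k : ℕ}
    (h0 : ∀ j < k, u (y + j) = 0) (h : u (y + k) ≠ 0) :
    ∃ x, u (y + k) = nxt m p (u x) ∧ k ≤ t (u x + 1) ∧ y + k = f x + t (u x + 1) := by
  obtain ⟨x, h1, -, h3⟩ := S.exists_of_ne_zero h
  refine ⟨x, h3, ?_, h1⟩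
  -- A longer run would contain the last letter of the preceding image, which is nonzero.
  by_contra! hk
  rcases Nat.eq_zero_or_pos x with rfl | hx
  · rw [S.f_zero] at h1; omega
  obtain ⟨x', rfl⟩ := Nat.exists_eq_succ_of_ne_zero hx.ne'
  have h4 := S.u_last x'
  have h5 := S.f_succ x'
  have h6 := h0 (k - t (u (x' + 1) + 1) - 1) (by omega)
  have h7 : y + (k - t (u (x' + 1) + 1) - 1) = f x' + t (u x' + 1) := by
    simp only [Nat.succ_eq_add_one] at *; omega
  rw [h7, h4] at h6
  exact nxt_ne_zero S.m_pos _ h6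

theorem iterate_add_of_zeros {n x : ℕ}
    (hn : ∀ x, f^[n] (x + 1) = f^[n] x + blockLen t m p n (u x)) {j : ℕ}
    (h : ∀ i < j, u (x + i) = 0) : f^[n] (x + j) = f^[n] x + j * blockLen t m p n 0 := by
  induction j with
  | zero => simp
  | succ j ih =>
    rw [← add_assoc, hn, ih fun i hi => h i (by omega), h j (by omega)]
    ring

theorem iterate_succ_apply (S : ParrySystem t m p u f β r) (n x : ℕ) :
    f^[n] (x + 1) = f^[n] x + blockLen t m p n (u x) := by
  induction n generalizing x with
  | zero => simp [blockLen]
  | succ n ih =>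
    rw [Function.iterate_succ_apply, Function.iterate_succ_apply, S.f_succ, ih,
      iterate_add_of_zeros ih (S.u_zeros x), S.u_last]
    simp only [blockLen]; ring

theorem iterate_add_zeros (S : ParrySystem t m p u f β r) (n : ℕ) {x j : ℕ}
    (h : ∀ i < j, u (x + i) = 0) : f^[n] (x + j) = f^[n] x + j * blockLen t m p n 0 :=
  iterate_add_of_zeros (S.iterate_succ_apply n) h

theorem iterate_strictMono (S : ParrySystem t m p u f β r) (n : ℕ) : StrictMono f^[n] :=
  S.f_strictMono.iterate n

theorem iterate_zero' (S : ParrySystem t m p u f β r) (n : ℕ) : f^[n] 0 = 0 :=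
  Function.iterate_fixed S.f_zero n

theorem iterate_one (S : ParrySystem t m p u f β r) (n : ℕ) :
    f^[n] 1 = blockLen t m p n 0 := by
  have := S.iterate_succ_apply n 0
  rwa [S.iterate_zero', S.u_zero, zero_add, zero_add] at this

/-- The letterwise statement `hn` is an assumption because this lemma serves in the induction that
proves it: one substitution turns equal letters into equal words, to which level `n` applies. -/
theorem image_of_match_aux {n : ℕ} (S : ParrySystem t m p u f β r)
    (hn : ∀ a b, u a = u b → ∀ i < blockLen t m p n (u a), u (f^[n] a + i) = u (f^[n] b + i))
    {a b k : ℕ} (h : ∀ j < k, u (a + j) = u (b + j)) :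
    f^[n] (a + k) + f^[n] b = f^[n] (b + k) + f^[n] a ∧
      ∀ i, f^[n] a + i < f^[n] (a + k) → u (f^[n] a + i) = u (f^[n] b + i) := by
  induction k with
  | zero => exact ⟨by simp [add_comm], fun i hi => by simp at hi⟩
  | succ k ih =>
    obtain ⟨h1, h2⟩ := ih fun j hj => h j (by omega)
    have h3 := h k (by omega)
    rw [← add_assoc, ← add_assoc, S.iterate_succ_apply, S.iterate_succ_apply, ← h3]
    refine ⟨by omega, fun i hi => ?_⟩
    by_cases hi' : f^[n] a + i < f^[n] (a + k)
    · exact h2 i hi'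
    · have h4 := hn _ _ h3 (f^[n] a + i - f^[n] (a + k)) (by omega)
      have h5 : f^[n] a ≤ f^[n] (a + k) := (S.iterate_strictMono n).monotone (by omega)
      have h6 : f^[n] b ≤ f^[n] (b + k) := (S.iterate_strictMono n).monotone (by omega)
      convert h4 using 2 <;> omega

/-- The content of the image of a letter depends on the letter only. -/
theorem image_of_letter (S : ParrySystem t m p u f β r) (n : ℕ) {a b : ℕ} (h : u a = u b) :
    ∀ i < blockLen t m p n (u a), u (f^[n] a + i) = u (f^[n] b + i) := by
  induction n generalizing a b with
  | zero =>
    intro i hi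
    have : i = 0 := by simp [blockLen] at hi; exact hi
    simpa [this] using h
  | succ n ih =>
    intro i hi
    have key := (S.image_of_match_aux (n := n) (fun a b hab => ih hab)
      (a := f a) (b := f b) (k := t (u a + 1) + 1) ?_).2 i ?_
    · simpa only [Function.iterate_succ_apply] using key
    · intro j hj
      rcases Nat.lt_succ_iff_lt_or_eq.1 hj with hj | rfl
      · rw [S.u_zeros a j hj, S.u_zeros b j (h ▸ hj)]
      · rw [S.u_last, h, S.u_last]
    · rw [← add_assoc, ← S.f_succ, ← Function.iterate_succ_apply, ← Function.iterate_succ_apply,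
        S.iterate_succ_apply]
      simp only [Nat.succ_eq_add_one]; omega

theorem image_of_match (S : ParrySystem t m p u f β r) (n : ℕ) {a b k : ℕ}
    (h : ∀ j < k, u (a + j) = u (b + j)) :
    f^[n] (a + k) + f^[n] b = f^[n] (b + k) + f^[n] a ∧
      ∀ i, f^[n] a + i < f^[n] (a + k) → u (f^[n] a + i) = u (f^[n] b + i) :=
  S.image_of_match_aux (fun _ _ hab => S.image_of_letter n hab) h

/-- Images of distinct letters differ before the shorter one ends. -/
theorem exists_mismatch (S : ParrySystem t m p u f β r) (n : ℕ) {a b : ℕ} (h : u a ≠ u b) :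
    ∃ j, j < blockLen t m p n (u a) ∧ j < blockLen t m p n (u b) ∧
      u (f^[n] a + j) ≠ u (f^[n] b + j) := by
  induction n generalizing a b with
  | zero => exact ⟨0, by simp [blockLen], by simp [blockLen], by simpa using h⟩
  | succ n ih =>
    -- With fewer zeros, the first image shows its nonzero last letter against a zero of the second,
    -- and induction applies to these two letters.
    have hlt : ∀ a b, t (u a + 1) < t (u b + 1) → ∃ j, j < blockLen t m p (n + 1) (u a) ∧
        j < blockLen t m p (n + 1) (u b) ∧ u (f^[n+1] a + j) ≠ u (f^[n+1] b + j) := by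
      intro a b hab
      have h1 := S.u_last a
      have h2 := S.u_zeros b _ hab
      obtain ⟨j, hj1, hj2, hj3⟩ := ih (a := f a + t (u a + 1)) (b := f b + t (u a + 1))
        (by rw [h1, h2]; exact nxt_ne_zero S.m_pos _)
      rw [h1] at hj1
      rw [h2] at hj2
      rw [S.iterate_add_zeros n (S.u_zeros a),
        S.iterate_add_zeros n (fun i hi => S.u_zeros b i (hi.trans hab))] at hj3
      refine ⟨t (u a + 1) * blockLen t m p n 0 + j, ?_, ?_, ?_⟩
      · simp only [blockLen]; omega
      · simp only [blockLen]
        have : (t (u a + 1) + 1) * blockLen t m p n 0 ≤ t (u b + 1) * blockLen t m p n 0 :=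
          Nat.mul_le_mul_right _ hab
        rw [add_mul] at this
        omega
      · simpa only [Function.iterate_succ_apply, ← add_assoc] using hj3
    rcases lt_trichotomy (t (u a + 1)) (t (u b + 1)) with hab | hab | hab
    · exact hlt a b hab
    -- Only `m - 1` and `m + p - 1` share a last letter, and their digits `t m` and `t (m + p)`
    -- differ.
    · have hne : nxt m p (u a) ≠ nxt m p (u b) := by
        intro heq
        have hm := S.m_pos
        have := S.digit_ne
        rcases eq_of_nxt_eq (S.u_lt a) (S.u_lt b) heq h with ⟨h1, h2⟩ | ⟨h1, h2⟩ <;>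
        · rw [h1, h2, Nat.sub_add_cancel (by omega), Nat.sub_add_cancel (by omega)] at hab
          omega
      have h1 := S.u_last a
      have h2 := S.u_last b
      rw [← hab] at h2
      obtain ⟨j, hj1, hj2, hj3⟩ := ih (a := f a + t (u a + 1)) (b := f b + t (u a + 1))
        (by rwa [h1, h2])
      rw [h1] at hj1
      rw [h2] at hj2
      rw [S.iterate_add_zeros n (S.u_zeros a),
        S.iterate_add_zeros n (fun i hi => S.u_zeros b i (hab ▸ hi))] at hj3
      refine ⟨t (u a + 1) * blockLen t m p n 0 + j, ?_, ?_, ?_⟩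
      · simp only [blockLen]; omega
      · simp only [blockLen, ← hab]; omega
      · simpa only [Function.iterate_succ_apply, ← add_assoc] using hj3
    · obtain ⟨j, h1, h2, h3⟩ := hlt b a hab
      exact ⟨j, h2, h1, h3.symm⟩

/-! ### The order of letters by remainder -/

/-- One step of lexicographic comparison: `β * r a` has integer part `t (a + 1)` and fractional part
`r (nxt m p a)`. Inductions along this step compare the images of two letters. -/
theorem digit_le_of_rem_le (S : ParrySystem t m p u f β r) {a b : ℕ} (h : r a ≤ r b)
    (ha : a < m + p) (hb : b < m + p) :
    t (a + 1) < t (b + 1) ∨ (t (a + 1) = t (b + 1) ∧ r (nxt m p a) ≤ r (nxt m p b)) := by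
  have h1 := S.rem_nxt ha
  have h2 := S.rem_nxt hb
  have h3 : β * r a ≤ β * r b := mul_le_mul_of_nonneg_left h (by linarith [S.one_lt])
  have h4 := S.rem_lt (nxt m p b) (Nat.one_le_iff_ne_zero.2 (nxt_ne_zero S.m_pos _))
  have h5 := S.rem_pos (nxt m p a)
  have h6 : (t (a + 1) : ℝ) < t (b + 1) + 1 := by linarith
  have h7 : t (a + 1) < t (b + 1) + 1 := by exact_mod_cast h6
  rcases Nat.lt_succ_iff_lt_or_eq.1 h7 with h8 | h8
  · exact Or.inl h8
  · refine Or.inr ⟨h8, ?_⟩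
    rw [h8] at h1
    linarith

theorem blockLen_le_of_rem_le (S : ParrySystem t m p u f β r) (n : ℕ) {a b : ℕ} (h : r a ≤ r b)
    (ha : a < m + p) (hb : b < m + p) : blockLen t m p n a ≤ blockLen t m p n b := by
  induction n generalizing a b with
  | zero => simp [blockLen]
  | succ n ih =>
    simp only [blockLen]
    rcases S.digit_le_of_rem_le h ha hb with h1 | ⟨h1, h2⟩
    · have h3 := ih (a := nxt m p a) (b := 0) (by rw [S.rem_zero]; exact S.rem_le_one _)
        (nxt_lt S.p_pos _) (by omega)
      have : (t (a + 1) + 1) * blockLen t m p n 0 ≤ t (b + 1) * blockLen t m p n 0 :=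
        Nat.mul_le_mul_right _ h1
      rw [add_mul] at this
      omega
    · have := ih h2 (nxt_lt S.p_pos _) (nxt_lt S.p_pos _)
      rw [h1]; omega

theorem blockLen_le_zero (S : ParrySystem t m p u f β r) (n : ℕ) {a : ℕ} (ha : a < m + p) :
    blockLen t m p n a ≤ blockLen t m p n 0 :=
  S.blockLen_le_of_rem_le n (by rw [S.rem_zero]; exact S.rem_le_one _) ha (by omega)

/-- The image of a letter, without its last letter, is a prefix of the image of any letter with a
larger remainder. -/
theorem image_prefix (S : ParrySystem t m p u f β r) (n : ℕ) {a b : ℕ} (h : r (u a) ≤ r (u b)) :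
    ∀ j, j + 1 < blockLen t m p n (u a) → u (f^[n] a + j) = u (f^[n] b + j) := by
  induction n generalizing a b with
  | zero => simp [blockLen]
  | succ n ih =>
    intro j hj
    have hz : ∀ i < t (u a + 1), u (f a + i) = u (f b + i) := fun i hi => by
      rw [S.u_zeros a i hi, S.u_zeros b i]
      rcases S.digit_le_of_rem_le h (S.u_lt a) (S.u_lt b) with h1 | ⟨h1, h2⟩ <;> omega
    have hzb : ∀ i < t (u a + 1), u (f b + i) = 0 := fun i hi => by
      rw [← hz i hi, S.u_zeros a i hi]
    have hr : r (u (f a + t (u a + 1))) ≤ r (u (f b + t (u a + 1))) := by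
      rw [S.u_last]
      rcases S.digit_le_of_rem_le h (S.u_lt a) (S.u_lt b) with h1 | ⟨h1, h2⟩
      · rw [S.u_zeros b _ h1, S.rem_zero]; exact S.rem_le_one _
      · rw [h1, S.u_last]; exact h2
    have h1 := S.image_of_match n hz
    have h2 := ih hr
    have h3 := S.iterate_add_zeros n (S.u_zeros a)
    have h4 := S.iterate_add_zeros n hzb
    rw [Function.iterate_succ_apply, Function.iterate_succ_apply]
    by_cases hj' : f^[n] (f a) + j < f^[n] (f a + t (u a + 1))
    · exact h1.2 j hj'
    · have h5 := h2 (j - t (u a + 1) * blockLen t m p n 0)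
        (by simp only [blockLen] at hj; rw [S.u_last]; omega)
      rw [h3, h4] at h5
      convert h5 using 2 <;> omega

end ParrySystem

/-! ### Common suffixes of images and the left letter `z` -/

/-- The length of the `n`-th image of the word `0^t m`. -/
def zeroBlockLen (t : ℕ → ℕ) (m p n : ℕ) : ℕ :=
  tMin t m p * blockLen t m p n 0 + blockLen t m p n m

/-- The length of the longest common suffix of the `n`-th images of two words of `u_β` ending in
the letters `a` and `b`, if `z` is the nonzero left extension of `0^t m`. -/
def commonSuffixLen (t : ℕ → ℕ) (m p z : ℕ) : ℕ → ℕ → ℕ → ℕ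
  | 0, _, _ => 0
  | n + 1, a, b =>
    if nxt m p a = nxt m p b then zeroBlockLen t m p n + commonSuffixLen t m p z n 0 z
    else commonSuffixLen t m p z n (nxt m p a) (nxt m p b)

/-- The length of the word `z^{(n)}`. -/
def zWordLen (t : ℕ → ℕ) (m p z n : ℕ) : ℕ :=
  if n < m then 0
  else if p ∣ z then ∑ j ∈ Finset.range (n / m), zeroBlockLen t m p (n % m + j * m)
  else zeroBlockLen t m p (n - m)

/-- `z` is the letter before every image of a letter that equals `0^t m`. -/
structure IsLeftLetter (t : ℕ → ℕ) (m p : ℕ) (u : ℕ → ℕ) (z : ℕ) : Prop where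
  ne_zero : z ≠ 0
  lt : z < m + p
  eq : ∀ x, nxt m p (u (x + 1)) = m → t (u (x + 1) + 1) = tMin t m p → nxt m p (u x) = z
  of_dvd : p ∣ z → 0 < tMin t m p ∨ (p < m ∧ 0 < t (m + p))

theorem nxt_eq_add_one {m p a : ℕ} (h : a + 1 < m + p) : nxt m p a = a + 1 := if_pos h

theorem nxt_eq_m {m p a : ℕ} (hm : 1 ≤ m) (ha : a < m + p) (h : nxt m p a = m) :
    a = m - 1 ∨ a = m + p - 1 := by
  unfold nxt at h; split_ifs at h <;> omega

theorem commonSuffixLen_comm (t : ℕ → ℕ) (m p z n a b : ℕ) :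
    commonSuffixLen t m p z n a b = commonSuffixLen t m p z n b a := by
  induction n generalizing a b with
  | zero => rfl
  | succ n ih =>
    simp only [commonSuffixLen, eq_comm (a := nxt m p a)]
    split_ifs
    · rfl
    · exact ih _ _

namespace ParrySystem

variable {t : ℕ → ℕ} {m p : ℕ} {u f : ℕ → ℕ} {β : ℝ} {r : ℕ → ℝ} {z : ℕ}

theorem u_f_succ_pred (S : ParrySystem t m p u f β r) {x y : ℕ} (h : y + 1 = f (x + 1)) :
    u y = nxt m p (u x) := by
  rw [S.f_succ] at h
  rw [← S.u_last]
  congr 1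
  omega

/-- An occurrence of `j` is preceded by `0`, since the image it ends contains zeros. As the next `k`
digits vanish, `φ^k` maps `j` to `j + k`, while `φ^k(0)` ends in `k`. The condition `hjm` covers the
second way of producing `m`, from `m + p - 1`; `hm` keeps `m` out of `j + 1, ..., j + k`, so that
each of these letters has one preimage. -/
theorem eq_of_succ_eq_add (S : ParrySystem t m p u f β r) {j : ℕ} (hj : 0 < j) (htj : 0 < t j)
    (hjm : j = m → 0 < t (m + p)) {k : ℕ} (hk : ∀ i, j < i → i ≤ j + k → t i = 0)
    (hlt : j + k < m + p) (hm : m ≤ j ∨ j + k < m) (x : ℕ) (hx : u (x + 1) = j + k) :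
    u x = k := by
  have hm1 := S.m_pos
  induction k generalizing x with
  | zero =>
    obtain ⟨y, h1, h2, h3⟩ := S.exists_of_ne_zero (y := x + 1) (by omega)
    have h4 : 0 < t (u y + 1) := by
      have h5 : j = nxt m p (u y) := by rw [← h3, hx]; rfl
      unfold nxt at h5
      split_ifs at h5 with h6
      · rwa [← h5]
      · have := S.u_lt y
        rw [show u y + 1 = m + p by omega]
        exact hjm h5
    have := S.u_zeros y (t (u y + 1) - 1) (by omega)
    rwa [show f y + (t (u y + 1) - 1) = x by omega] at this
  | succ k ih =>
    obtain ⟨y, h1, h2, h3⟩ := S.exists_of_ne_zero (y := x + 1) (by omega)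
    have h4 : u y = j + k := by
      rw [hx] at h3
      unfold nxt at h3
      split_ifs at h3 <;> omega
    rw [h4, hk _ (by omega) (by omega), add_zero] at h1
    have hy : y ≠ 0 := by rintro rfl; rw [S.f_zero] at h1; omega
    obtain ⟨y', rfl⟩ := Nat.exists_eq_succ_of_ne_zero hy
    have h5 := ih (fun i h1 h2 => hk i h1 (by omega)) (by omega) (by omega) y' h4
    rw [S.u_f_succ_pred h1, h5, nxt_eq_add_one (by omega)]

/-- The smaller of `t m`, `t (m + p)` tells which of `m - 1`, `m + p - 1` has image `0^t m`. Going
back from that letter through vanishing digits to the last positive one, at index `j`, gives `z = m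
- j` or `z = m + p - j` by `eq_of_succ_eq_add`. -/
theorem exists_isLeftLetter (S : ParrySystem t m p u f β r) :
    ∃ z, IsLeftLetter t m p u z := by
  have hm1 := S.m_pos
  have hp1 := S.p_pos
  have hne := S.digit_ne
  have h3 := S.three_le
  rcases lt_or_gt_of_ne hne with hlt | hlt
  · have hm2 : 2 ≤ m := by
      by_contra! h
      obtain rfl : m = 1 := by omega
      have := S.digit_le p
      rw [add_comm] at this
      omega
    have hT : tMin t m p = t m := min_eq_left hlt.le
    set j := Nat.findGreatest (fun j => 0 < t j) (m - 1) with hj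
    have hj1 : 1 ≤ j := Nat.le_findGreatest (by omega) (by omega)
    have hj2 : j ≤ m - 1 := Nat.findGreatest_le _
    have hj3 : 0 < t j := Nat.findGreatest_spec (P := fun j => 0 < t j) (m := 1) (by omega)
      (by omega)
    have hj4 : ∀ i, j < i → i ≤ m - 1 → t i = 0 := fun i h1 h2 => by
      have := Nat.findGreatest_is_greatest h1 h2; omega
    refine ⟨m - j, by omega, by omega, fun x hx hxt => ?_, fun hpz => Or.inr ⟨?_, by omega⟩⟩
    · rcases nxt_eq_m hm1 (S.u_lt _) hx with h | h
      · have := S.eq_of_succ_eq_add (j := j) (k := m - 1 - j) (by omega) hj3 (by omega)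
          (fun i h1 h2 => hj4 i h1 (by omega)) (by omega) (by omega) x (by omega)
        rw [this, nxt_eq_add_one (by omega)]; omega
      · rw [h, Nat.sub_add_cancel (by omega)] at hxt
        omega
    · have := Nat.le_of_dvd (by omega) hpz
      omega
  · have hT : tMin t m p = t (m + p) := min_eq_right hlt.le
    set j := Nat.findGreatest (fun j => 0 < t j) (m + p - 1) with hj
    have hj1 : m ≤ j := Nat.le_findGreatest (by omega) (by omega)
    have hj2 : j ≤ m + p - 1 := Nat.findGreatest_le _
    have hj3 : 0 < t j := Nat.findGreatest_spec (P := fun j => 0 < t j) (m := m) (by omega)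
      (by omega)
    have hj4 : ∀ i, j < i → i ≤ m + p - 1 → t i = 0 := fun i h1 h2 => by
      have := Nat.findGreatest_is_greatest h1 h2; omega
    -- If all digits strictly between `m` and `m + p` vanish, the period still needs a nonzero
    -- digit.
    have hj5 : j = m → 0 < t (m + p) := fun h => by
      obtain ⟨i, hi1, hi2, hi3⟩ := S.exists_digit_pos
      rcases Nat.lt_or_ge i (m + p) with hi | hi
      · have := hj4 i (by omega) (by omega); omega
      · rwa [show m + p = i by omega]
    refine ⟨m + p - j, by omega, by omega, fun x hx hxt => ?_, fun hpz => Or.inl ?_⟩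
    · rcases nxt_eq_m hm1 (S.u_lt _) hx with h | h
      · rw [h, Nat.sub_add_cancel (by omega)] at hxt
        omega
      · have := S.eq_of_succ_eq_add (j := j) (k := m + p - 1 - j) (by omega) hj3 hj5
          (fun i h1 h2 => hj4 i h1 (by omega)) (by omega) (by omega) x (by omega)
        rw [this, nxt_eq_add_one (by omega)]; omega
    · have := Nat.le_of_dvd (by omega) hpz
      rw [hT]
      exact hj5 (by omega)

/-- An image of a letter that ends in `m` ends in `0^t m`, preceded by `z` or `0`. -/
theorem exists_before_zeroBlock (S : ParrySystem t m p u f β r) (hz : IsLeftLetter t m p u z)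
    {x : ℕ} (hx : nxt m p (u x) = m) :
    ∃ y, y + 1 + (tMin t m p + 1) = f (x + 1) ∧ (∀ j < tMin t m p, u (y + 1 + j) = 0) ∧
      u (y + 1 + tMin t m p) = m ∧
      ((t (u x + 1) = tMin t m p ∧ u y = z) ∨ (t (u x + 1) ≠ tMin t m p ∧ u y = 0)) := by
  have hm1 := S.m_pos
  have hp1 := S.p_pos
  have hle : tMin t m p ≤ t (u x + 1) := by
    rcases nxt_eq_m hm1 (S.u_lt x) hx with h | h
    · rw [h, Nat.sub_add_cancel (by omega)]; exact min_le_left _ _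
    · rw [h, Nat.sub_add_cancel (by omega)]; exact min_le_right _ _
  -- The block `0^t m` is not at the very beginning of `u`: the first image ends in `m` only if `m =
  -- 1`, and then `t 1` exceeds `t (1 + p)`.
  have hpos : tMin t m p < f x + t (u x + 1) := by
    rcases Nat.eq_zero_or_pos x with rfl | h0
    · rw [S.u_zero, S.f_zero] at *
      rcases nxt_eq_m hm1 (by omega) hx with h | h
      · obtain rfl : m = 1 := by omega
        have h1 := S.digit_ne
        have h2 := S.digit_le p
        have : tMin t 1 p ≤ t (1 + p) := min_le_right _ _
        rw [add_comm 1 p] at *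
        simp only [zero_add] at *
        omega
      · omega
    · have := S.f_strictMono h0
      omega
  refine ⟨f x + t (u x + 1) - tMin t m p - 1, by rw [S.f_succ]; omega, fun j hj => ?_, ?_, ?_⟩
  · have := S.u_zeros x (t (u x + 1) - tMin t m p + j) (by omega)
    rw [← this]; congr 1; omega
  · exact (congrArg u (by omega)).trans ((S.u_last x).trans hx)
  · by_cases h : t (u x + 1) = tMin t m p
    · refine Or.inl ⟨h, ?_⟩
      have hx0 : x ≠ 0 := by rintro rfl; rw [S.f_zero] at hpos; omega
      obtain ⟨x', rfl⟩ := Nat.exists_eq_succ_of_ne_zero hx0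
      rw [← hz.eq x' hx h]
      exact S.u_f_succ_pred (by simp only [Nat.succ_eq_add_one] at *; omega)
    · refine Or.inr ⟨h, ?_⟩
      have := S.u_zeros x (t (u x + 1) - tMin t m p - 1) (by omega)
      rw [← this]; congr 1; omega

theorem iterate_add_zeroBlock (S : ParrySystem t m p u f β r) (n : ℕ) {y : ℕ}
    (h0 : ∀ j < tMin t m p, u (y + j) = 0) (h1 : u (y + tMin t m p) = m) :
    f^[n] (y + (tMin t m p + 1)) = f^[n] y + zeroBlockLen t m p n := by
  rw [← add_assoc, S.iterate_succ_apply, S.iterate_add_zeros n h0, h1, zeroBlockLen, add_assoc]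

theorem tMin_eq_iff (S : ParrySystem t m p u f β r) {a b : ℕ} (ha : a < m + p) (hb : b < m + p)
    (h : nxt m p a = nxt m p b) (hab : a ≠ b) :
    nxt m p a = m ∧ (t (a + 1) = tMin t m p ↔ t (b + 1) ≠ tMin t m p) := by
  have hm1 := S.m_pos
  have hp1 := S.p_pos
  have hne := S.digit_ne
  have hmin : tMin t m p = min (t m) (t (m + p)) := rfl
  rcases eq_of_nxt_eq ha hb h hab with ⟨rfl, rfl⟩ | ⟨rfl, rfl⟩
  · rw [Nat.sub_add_cancel (by omega), Nat.sub_add_cancel (by omega)]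
    refine ⟨by rw [nxt_eq_add_one] <;> omega, by omega⟩
  · rw [Nat.sub_add_cancel (by omega), Nat.sub_add_cancel (by omega)]
    refine ⟨by unfold nxt; rw [if_neg] ; omega, by omega⟩

/-- The common suffix of images of prefixes of `u` ending in distinct letters. -/
theorem commonSuffix_spec (S : ParrySystem t m p u f β r) (hz : IsLeftLetter t m p u z) (n : ℕ)
    {x y : ℕ} (h : u x ≠ u y) :
    ∃ X Y, X + 1 + commonSuffixLen t m p z n (u x) (u y) = f^[n] (x + 1) ∧
      Y + 1 + commonSuffixLen t m p z n (u x) (u y) = f^[n] (y + 1) ∧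
      (∀ j < commonSuffixLen t m p z n (u x) (u y), u (X + 1 + j) = u (Y + 1 + j)) ∧
      u X ≠ u Y := by
  induction n generalizing x y with
  | zero => exact ⟨x, y, by simp [commonSuffixLen], by simp [commonSuffixLen],
      by simp [commonSuffixLen], h⟩
  | succ n ih =>
    rw [Function.iterate_succ_apply, Function.iterate_succ_apply]
    by_cases heq : nxt m p (u x) = nxt m p (u y)
    · simp only [commonSuffixLen, if_pos heq]
      obtain ⟨hxm, hiff⟩ := S.tMin_eq_iff (S.u_lt x) (S.u_lt y) heq h
      obtain ⟨a, ha1, ha2, ha3, ha4⟩ := S.exists_before_zeroBlock hz hxm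
      obtain ⟨b, hb1, hb2, hb3, hb4⟩ := S.exists_before_zeroBlock hz (heq ▸ hxm)
      have hz0 := hz.ne_zero
      -- Exactly one of the two images has the smaller digit, so `z` stands before one block `0^t m`
      -- and `0` before the other.
      have hab : u a ≠ u b ∧ commonSuffixLen t m p z n (u a) (u b) =
          commonSuffixLen t m p z n 0 z := by
        rcases ha4 with ⟨ha4, ha5⟩ | ⟨ha4, ha5⟩ <;> rcases hb4 with ⟨hb4, hb5⟩ | ⟨hb4, hb5⟩
        · exact absurd hb4 (hiff.1 ha4)
        · rw [ha5, hb5]; exact ⟨hz0, commonSuffixLen_comm _ _ _ _ _ _ _⟩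
        · rw [ha5, hb5]; exact ⟨hz0.symm, rfl⟩
        · exact absurd (hiff.2 hb4) ha4
      obtain ⟨X, Y, h1, h2, h3, h4⟩ := ih hab.1
      rw [hab.2] at h1 h2 h3
      have h5 := S.iterate_add_zeroBlock n ha2 ha3
      have h6 := S.iterate_add_zeroBlock n hb2 hb3
      have h7 := S.image_of_match n (a := a + 1) (b := b + 1) (k := tMin t m p + 1) (by
        intro j hj
        rcases Nat.lt_succ_iff_lt_or_eq.1 hj with hj | rfl
        · rw [ha2 j hj, hb2 j hj]
        · rw [ha3, hb3])
      rw [ha1] at h5 h7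
      rw [hb1] at h6 h7
      refine ⟨X, Y, by omega, by omega, fun j hj => ?_, h4⟩
      by_cases hj' : j < commonSuffixLen t m p z n 0 z
      · exact h3 j hj'
      · have := h7.2 (j - commonSuffixLen t m p z n 0 z) (by omega)
        convert this using 2 <;> omega
    · simp only [commonSuffixLen, if_neg heq]
      have := ih (x := f x + t (u x + 1)) (y := f y + t (u y + 1)) (by rwa [S.u_last, S.u_last])
      rw [S.u_last, S.u_last] at this
      rw [S.f_succ, S.f_succ]
      exact this

theorem zeroBlockLen_le (S : ParrySystem t m p u f β r) (n : ℕ) {a : ℕ} (ha : a < m + p)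
    (h : nxt m p a = m) : zeroBlockLen t m p n ≤ blockLen t m p (n + 1) a := by
  have hm1 := S.m_pos
  have hp1 := S.p_pos
  simp only [zeroBlockLen, blockLen, h]
  have : tMin t m p ≤ t (a + 1) := by
    rcases nxt_eq_m hm1 ha h with rfl | rfl
    · rw [Nat.sub_add_cancel (by omega)]; exact min_le_left _ _
    · rw [Nat.sub_add_cancel (by omega)]; exact min_le_right _ _
  have := Nat.mul_le_mul_right (blockLen t m p n 0) this
  omega

/-- Isolates the first meeting in the letter `m`. The block shared there is a suffix of the image of
`b`, so it is no longer than a period whose base word ends in `b`; only the tail after the restart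
needs a separate bound. -/
theorem commonSuffixLen_le (S : ParrySystem t m p u f β r) (z n : ℕ) {a b : ℕ} (ha : a < m + p)
    (hb : b < m + p) (hab : a ≠ b) : commonSuffixLen t m p z n a b = 0 ∨
      ∃ N, commonSuffixLen t m p z n a b =
          zeroBlockLen t m p N + commonSuffixLen t m p z N 0 z ∧
        zeroBlockLen t m p N ≤ blockLen t m p n b := by
  induction n generalizing a b with
  | zero => exact Or.inl rfl
  | succ n ih =>
    simp only [commonSuffixLen]
    split_ifs with h
    · exact Or.inr ⟨n, rfl, S.zeroBlockLen_le n hb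
        (h ▸ (S.tMin_eq_iff ha hb h hab).1)⟩
    · rcases ih (nxt_lt S.p_pos _) (nxt_lt S.p_pos _) h with h1 | ⟨N, h1, h2⟩
      · exact Or.inl h1
      · exact Or.inr ⟨N, h1, h2.trans (blockLen_nxt_le ..)⟩

/-! ### Residues modulo `p` and the length of `z^{(n)}` -/

theorem nxt_modEq {a : ℕ} (ha : a < m + p) : nxt m p a ≡ a + 1 [MOD p] := by
  unfold nxt
  split_ifs with h
  · rfl
  · rw [show a + 1 = m + p by omega]
    simp [Nat.ModEq]

/-- Last letters advance by one modulo `p`, so incongruent letters never meet. -/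
theorem commonSuffixLen_eq_zero (S : ParrySystem t m p u f β r) (z n : ℕ) {a b : ℕ}
    (ha : a < m + p) (hb : b < m + p) (hab : ¬ a ≡ b [MOD p]) :
    commonSuffixLen t m p z n a b = 0 := by
  induction n generalizing a b with
  | zero => rfl
  | succ n ih =>
    have h : ¬ nxt m p a ≡ nxt m p b [MOD p] := fun h => hab <|
      Nat.ModEq.add_right_cancel' 1 (((nxt_modEq ha).symm.trans h).trans (nxt_modEq hb))
    have h' : nxt m p a ≠ nxt m p b := fun e => h (by rw [e])
    simp only [commonSuffixLen, if_neg h']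
    exact ih (nxt_lt S.p_pos _) (nxt_lt S.p_pos _) h

/-- The smaller letter needs `m - a` steps to become `m`. Until then the other one stays strictly
larger, even when it wraps around to `m`, and congruence forces them to meet exactly at that moment.
-/
theorem commonSuffixLen_of_modEq (S : ParrySystem t m p u f β r) (z n : ℕ) {a b : ℕ}
    (ha : a < m) (hb : b < m + p) (hlt : a < b) (hab : a ≡ b [MOD p]) :
    commonSuffixLen t m p z n a b = if n < m - a then 0 else
      zeroBlockLen t m p (n - (m - a)) + commonSuffixLen t m p z (n - (m - a)) 0 z := by
  have hm1 := S.m_pos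
  have hp1 := S.p_pos
  induction n generalizing a b with
  | zero => rw [if_pos (by omega)]; rfl
  | succ n ih =>
    have h1 : nxt m p a = a + 1 := nxt_eq_add_one (by omega)
    have h2 : nxt m p a ≡ nxt m p b [MOD p] :=
      ((nxt_modEq (by omega)).trans (hab.add_right 1)).trans (nxt_modEq hb).symm
    simp only [commonSuffixLen]
    rcases Nat.lt_or_ge (a + 1) m with h | h
    · have h3 : nxt m p a < nxt m p b := by
        rw [h1]; unfold nxt; split_ifs <;> omega
      rw [if_neg h3.ne, ih (by omega) (nxt_lt hp1 _) h3 h2, h1,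
        show n - (m - (a + 1)) = n + 1 - (m - a) by omega]
      by_cases h4 : n < m - (a + 1)
      · rw [if_pos h4, if_pos (by omega)]
      · rw [if_neg h4, if_neg (by omega)]
    · have h3 : b = m + p - 1 := by
        -- Here `a = m - 1`, so `b - a` is a positive multiple of `p` that is at most `p`.
        have h4 : p ∣ b - a := (Nat.modEq_iff_dvd' hlt.le).1 hab
        have := Nat.le_of_dvd (by omega) h4
        omega
      have h5 : nxt m p b = m := by unfold nxt; rw [if_neg (by omega)]
      rw [if_pos (by rw [h1, h5]; omega), if_neg (by omega), show n + 1 - (m - a) = n by omega]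

theorem commonSuffixLen_z (S : ParrySystem t m p u f β r) (hz0 : z ≠ 0) (hz : z < m + p)
    (hpz : p ∣ z) (n : ℕ) : commonSuffixLen t m p z n 0 z = zWordLen t m p z n := by
  have hm1 := S.m_pos
  induction n using Nat.strong_induction_on with
  | _ n ih =>
    rw [S.commonSuffixLen_of_modEq z n (by omega) hz (by omega)
      ((Nat.modEq_zero_iff_dvd.2 hpz).symm), Nat.sub_zero]
    unfold zWordLen
    split_ifs with h
    · rfl
    · have h1 : n / m = (n - m) / m + 1 := by
        rw [← Nat.add_div_right _ hm1, Nat.sub_add_cancel (by omega)]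
      have h2 : n % m = (n - m) % m := by rw [Nat.mod_eq_sub_mod (by omega)]
      have h3 : (n - m) % m + (n - m) / m * m = n - m := by
        rw [mul_comm]; exact Nat.mod_add_div _ _
      rw [ih _ (by omega), h1, h2, Finset.sum_range_succ, h3, add_comm]
      congr 1
      unfold zWordLen
      split_ifs with h4
      · rw [Nat.div_eq_of_lt h4]; simp
      · rfl

/-- The first meeting of `0` and `d` takes `m` steps whatever the multiple `d` of `p`; afterwards
only the pair `0, z` matters, and it contributes nothing if `p ∤ z`. -/
theorem commonSuffixLen_eq_zWordLen (S : ParrySystem t m p u f β r) (hz0 : z ≠ 0)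
    (hz : z < m + p) (n : ℕ) {d : ℕ} (hd0 : d ≠ 0) (hd : d < m + p) (hpd : p ∣ d) :
    commonSuffixLen t m p z n 0 d = zWordLen t m p z n := by
  have hm1 := S.m_pos
  by_cases hpz : p ∣ z
  · rw [← S.commonSuffixLen_z hz0 hz hpz,
      S.commonSuffixLen_of_modEq z n (by omega) hd (by omega)
        ((Nat.modEq_zero_iff_dvd.2 hpd).symm),
      S.commonSuffixLen_of_modEq z n (by omega) hz (by omega)
        ((Nat.modEq_zero_iff_dvd.2 hpz).symm)]
  · rw [S.commonSuffixLen_of_modEq z n (by omega) hd (by omega)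
        ((Nat.modEq_zero_iff_dvd.2 hpd).symm), Nat.sub_zero]
    unfold zWordLen
    split_ifs
    · rfl
    · rw [S.commonSuffixLen_eq_zero z _ (by omega) hz, add_zero]
      exact fun h => hpz (Nat.modEq_zero_iff_dvd.1 h.symm)

theorem commonSuffixLen_le_zWordLen (S : ParrySystem t m p u f β r) (hz0 : z ≠ 0)
    (hz : z < m + p) (n : ℕ) {d : ℕ} (hd0 : d ≠ 0) (hd : d < m + p) :
    commonSuffixLen t m p z n d 0 ≤ zWordLen t m p z n := by
  rw [commonSuffixLen_comm]
  by_cases hpd : p ∣ d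
  · exact (S.commonSuffixLen_eq_zWordLen hz0 hz n hd0 hd hpd).le
  · rw [S.commonSuffixLen_eq_zero z _ (by omega) hd]
    · exact Nat.zero_le _
    · exact fun h => hpd (Nat.modEq_zero_iff_dvd.1 h.symm)

theorem zWordLen_add (S : ParrySystem t m p u f β r) (hz0 : z ≠ 0) (hz : z < m + p)
    (hpz : p ∣ z) (n : ℕ) :
    zWordLen t m p z (n + m) = zeroBlockLen t m p n + zWordLen t m p z n := by
  have hm1 := S.m_pos
  rw [← S.commonSuffixLen_z hz0 hz hpz, ← S.commonSuffixLen_z hz0 hz hpz,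
    S.commonSuffixLen_of_modEq z _ (by omega) hz (by omega)
      ((Nat.modEq_zero_iff_dvd.2 hpz).symm), if_neg (by omega), Nat.sub_zero,
    Nat.add_sub_cancel]

/-! ### Upper bounds for the length of `z^{(n)}` -/

theorem blockLen_zero_mono (S : ParrySystem t m p u f β r) {k n : ℕ} (h : k ≤ n) :
    blockLen t m p k 0 ≤ blockLen t m p n 0 := by
  induction n, h using Nat.le_induction with
  | base => rfl
  | succ n _ ih =>
    have := S.three_le
    simp only [blockLen, zero_add]
    nlinarith [Nat.zero_le (blockLen t m p n (nxt m p 0))]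

theorem blockLen_add_le (t : ℕ → ℕ) {m p : ℕ} (k j a : ℕ) (h : a + j < m + p) :
    blockLen t m p k (a + j) ≤ blockLen t m p (k + j) a := by
  induction j generalizing k a with
  | zero => simp
  | succ j ih =>
    have h1 := ih k (a + 1) (by omega)
    have h2 := blockLen_nxt_le t m p (k + j) a
    rw [nxt_eq_add_one (by omega)] at h2
    rw [show a + (j + 1) = a + 1 + j by ring]
    exact h1.trans h2

theorem blockLen_zero_add_le (S : ParrySystem t m p u f β r) (k : ℕ) {j : ℕ} (hj : 1 ≤ j)
    (h : j < m + p) : blockLen t m p k j + blockLen t m p k 0 ≤ blockLen t m p (k + j) 0 := by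
  obtain ⟨i, rfl⟩ := Nat.exists_eq_add_of_le' hj
  have h1 := blockLen_add_le t (m := m) (p := p) k i 1 (by omega)
  have h2 := S.three_le
  have h3 := S.blockLen_zero_mono (show k ≤ k + i by omega)
  rw [← add_assoc, add_comm i 1]
  simp only [blockLen, zero_add, nxt_eq_add_one (show 0 + 1 < m + p by omega)]
  nlinarith

/-- `φ^m(0)` has room for `0^t m` and one more `0`. For `m = 1` this needs `t < t 1`; for `m > 1`
the block fits into the image of `m - 1`. It is the induction step for `zWordLen_le_blockLen`. -/
theorem zeroBlockLen_add_le (S : ParrySystem t m p u f β r) (k : ℕ) :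
    zeroBlockLen t m p k + blockLen t m p k 0 ≤ blockLen t m p (k + m) 0 := by
  have hm1 := S.m_pos
  have hp1 := S.p_pos
  unfold zeroBlockLen
  have hT : tMin t m p ≤ t m := min_le_left _ _
  obtain ⟨i, hi⟩ := Nat.exists_eq_add_of_le' hm1
  rcases Nat.eq_zero_or_pos i with rfl | hi0
  · obtain rfl : m = 1 := by omega
    have h1 := S.digit_ne
    have h2 := S.digit_le p
    have h3 : tMin t 1 p ≤ t (p + 1) := by rw [add_comm p 1]; exact min_le_right _ _
    rw [add_comm 1 p] at h1
    simp only [blockLen, zero_add, nxt_eq_add_one (show 0 + 1 < 1 + p by omega)]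
    have : (tMin t 1 p + 1) * blockLen t 1 p k 0 ≤ t 1 * blockLen t 1 p k 0 :=
      Nat.mul_le_mul_right _ (by omega)
    rw [add_mul] at this
    omega
  · have h1 := S.blockLen_zero_add_le (k + 1) hi0 (by omega)
    have h2 := S.blockLen_zero_mono (show k ≤ k + 1 by omega)
    have h3 : blockLen t m p (k + 1) i = t m * blockLen t m p k 0 + blockLen t m p k m := by
      rw [blockLen, nxt_eq_add_one (by omega), ← hi]
    have h4 := Nat.mul_le_mul_right (blockLen t m p k 0) hT
    rw [show k + m = k + 1 + i by omega]
    omega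

theorem zWordLen_le_blockLen (S : ParrySystem t m p u f β r) (hz0 : z ≠ 0) (hz : z < m + p)
    (hpz : p ∣ z) (n : ℕ) : zWordLen t m p z n ≤ blockLen t m p n 0 := by
  induction n using Nat.strong_induction_on with
  | _ n ih =>
    have hm1 := S.m_pos
    rcases Nat.lt_or_ge n m with h | h
    · simp [zWordLen, h]
    · obtain ⟨k, rfl⟩ := Nat.exists_eq_add_of_le' h
      rw [S.zWordLen_add hz0 hz hpz]
      have := ih k (by omega)
      have := S.zeroBlockLen_add_le k
      omega

/-- Controls the tail left by `commonSuffixLen_le`. If `t > 0`, the block contains a `0`, whose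
image is long enough. If `t = 0`, the field `of_dvd` gives `p < m` and `t (m + p) > 0`, so `φ^p(m)`
contains a `0` and the image of `m` at level `k + m` is at least as long as that of `0` at level `k
+ 1`. -/
theorem zWordLen_le_zeroBlockLen (S : ParrySystem t m p u f β r) (hz : IsLeftLetter t m p u z)
    (hpz : p ∣ z) (n : ℕ) : zWordLen t m p z n ≤ zeroBlockLen t m p n := by
  have hm1 := S.m_pos
  have hp1 := S.p_pos
  rcases hz.of_dvd hpz with hT | ⟨hpm, htp⟩
  · have h1 := S.zWordLen_le_blockLen hz.ne_zero hz.lt hpz n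
    have h2 := Nat.mul_le_mul_right (blockLen t m p n 0) hT
    unfold zeroBlockLen
    omega
  · rcases Nat.lt_or_ge n m with h | h
    · simp [zWordLen, h]
    · obtain ⟨k, rfl⟩ := Nat.exists_eq_add_of_le' h
      rw [S.zWordLen_add hz.ne_zero hz.lt hpz]
      have h1 := S.zWordLen_le_blockLen hz.ne_zero hz.lt hpz k
      rcases Nat.eq_zero_or_pos (tMin t m p) with hT | hT
      · have h2 : blockLen t m p (k + 1) 0 ≤ blockLen t m p (k + m - p) 0 :=
          S.blockLen_zero_mono (by omega)
        have h3 : blockLen t m p (k + m - p + 1) (m + (p - 1)) ≤ _ :=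
          blockLen_add_le t (k + m - p + 1) (p - 1) m (by omega)
        rw [show k + m - p + 1 + (p - 1) = k + m by omega] at h3
        have h4 : blockLen t m p (k + m - p) 0 ≤
            blockLen t m p (k + m - p + 1) (m + (p - 1)) := by
          rw [blockLen, show m + (p - 1) + 1 = m + p by omega]
          nlinarith [Nat.zero_le (blockLen t m p (k + m - p) (nxt m p (m + (p - 1))))]
        have h5 := S.blockLen_zero_add_le k (j := 1) le_rfl (by omega)
        have h6 := S.blockLen_le_zero k (a := m) (by omega)
        have h7 : 2 * blockLen t m p k 0 ≤ blockLen t m p (k + 1) 0 := by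
          have := S.three_le
          simp only [blockLen, zero_add]
          nlinarith [Nat.zero_le (blockLen t m p k (nxt m p 0))]
        simp only [zeroBlockLen, hT, zero_mul, zero_add]
        omega
      · have h2 := S.zWordLen_le_blockLen hz.ne_zero hz.lt hpz (k + m)
        rw [S.zWordLen_add hz.ne_zero hz.lt hpz] at h2
        have h3 := Nat.mul_le_mul_right (blockLen t m p (k + m) 0) hT
        refine h2.trans ?_
        unfold zeroBlockLen
        omega

/-! ### Desubstitution and the bound on repetitions -/

theorem lt_blockLen_zero (S : ParrySystem t m p u f β r) (n : ℕ) : n < blockLen t m p n 0 := by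
  induction n with
  | zero => simp [blockLen]
  | succ n ih =>
    have := S.three_le
    simp only [blockLen, zero_add]
    nlinarith

theorem exists_ne_zero (S : ParrySystem t m p u f β r) (a : ℕ) : ∃ k, u (a + k) ≠ 0 := by
  obtain ⟨x, -, h⟩ := S.exists_block a
  refine ⟨f (x + 1) - 1 - a, ?_⟩
  rw [show a + (f (x + 1) - 1 - a) = f (x + 1) - 1 by omega, S.u_f_succ_pred (x := x) (by omega)]
  exact nxt_ne_zero S.m_pos _

/-- Desubstitution of a repetition: it is obtained, by iterating the substitution, from a pair of
positions `a < b` around which only zeros match. -/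
theorem exists_desubstitution (S : ParrySystem t m p u f β r) (hz : IsLeftLetter t m p u z)
    {x q B : ℕ} (hq : 1 ≤ q) (hB : ∀ j < B, u (x + j) = u (x + q + j))
    (hleft : ∀ y, x = y + 1 → u y ≠ u (y + q)) :
    ∃ n a b k, a ≤ b ∧ f^[n] (b + 1) = f^[n] a + q ∧
      (∀ j < k, u (a + j) = 0 ∧ u (b + 1 + j) = 0) ∧
      ¬ (u (a + k) = 0 ∧ u (b + 1 + k) = 0) ∧
      x + B < f^[n] (a + k) + blockLen t m p n (u (a + k)) ∧
      x + B < f^[n] (a + k) + blockLen t m p n (u (b + 1 + k)) ∧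
      (f^[n] a ≤ x ∨ ∃ a', a = a' + 1 ∧ u a' ≠ u b ∧
        f^[n] a ≤ x + commonSuffixLen t m p z n (u a') (u b)) := by
  classical
  -- `P n`: some boundary between images at level `n` inside the matching stretch is shifted by `q`
  -- to another such boundary. The largest such `n` and then the leftmost such boundary are taken.
  set P : ℕ → Prop := fun n => ∃ a b, x ≤ f^[n] a ∧ f^[n] a ≤ x + B ∧ f^[n] b = f^[n] a + q
    with hP
  have hbound : ∀ n, P n → n ≤ x + B + q := by
    rintro n ⟨a, b, h1, h2, h3⟩
    have hb : b ≠ 0 := by rintro rfl; rw [S.iterate_zero'] at h3; omega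
    have h4 : f^[n] 1 ≤ f^[n] b := (S.iterate_strictMono n).monotone (by omega)
    rw [S.iterate_one] at h4
    have := S.lt_blockLen_zero n
    omega
  set n := Nat.findGreatest P (x + B + q) with hn
  have hPn : P n := Nat.findGreatest_spec (P := P) (m := 0) (Nat.zero_le _)
    ⟨x, x + q, by simp, by simp, by simp⟩
  have hPn1 : ¬ P (n + 1) := fun h =>
    Nat.findGreatest_is_greatest (Nat.lt_succ_self n) (hbound _ h) h
  have hex : ∃ a, ∃ b, x ≤ f^[n] a ∧ f^[n] a ≤ x + B ∧ f^[n] b = f^[n] a + q := hPn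
  obtain ⟨b, ha1, ha2, hab⟩ := Nat.find_spec hex
  have hmin := fun a' (h : a' < Nat.find hex) => Nat.find_min hex h
  set a := Nat.find hex
  have hlt : a < b := (S.iterate_strictMono n).lt_iff_lt.1 (by omega)
  obtain ⟨b, rfl⟩ := Nat.exists_eq_succ_of_ne_zero (show b ≠ 0 by omega)
  simp only [Nat.succ_eq_add_one] at *
  have hk : ∃ k, ¬ (u (a + k) = 0 ∧ u (b + 1 + k) = 0) := by
    obtain ⟨k, hk⟩ := S.exists_ne_zero a
    exact ⟨k, fun h => hk h.1⟩
  have hk1 := Nat.find_spec hk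
  have hk2 : ∀ j < Nat.find hk, u (a + j) = 0 ∧ u (b + 1 + j) = 0 := fun j hj => by
    have := Nat.find_min hk hj
    tauto
  set k := Nat.find hk
  have hXY : f^[n] (b + 1 + k) = f^[n] (a + k) + q := by
    have := (S.image_of_match n (a := a) (b := b + 1) (k := k)
      fun j hj => by rw [(hk2 j hj).1, (hk2 j hj).2]).1
    omega
  have hxX : x ≤ f^[n] (a + k) :=
    ha1.trans ((S.iterate_strictMono n).monotone (by omega))
  have hright : x + B < f^[n] (a + k) + blockLen t m p n (u (a + k)) ∧
      x + B < f^[n] (a + k) + blockLen t m p n (u (b + 1 + k)) := by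
    by_cases heq : u (a + k) = u (b + 1 + k)
    · rw [← heq, and_self]
      by_contra! hle
      have h0 : u (a + k) ≠ 0 := fun h => hk1 ⟨h, heq ▸ h⟩
      obtain ⟨a', -, ha', -⟩ := S.exists_of_ne_zero h0
      obtain ⟨b', -, hb', -⟩ := S.exists_of_ne_zero (heq ▸ h0)
      -- Equal nonzero letters end images of letters, so the boundaries after them belong to level
      -- `n + 1`; if they still lie in the matching stretch, `n` is not maximal.
      refine hPn1 ⟨a' + 1, b' + 1, ?_⟩
      rw [Function.iterate_succ_apply, Function.iterate_succ_apply, ← ha', ← hb',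
        S.iterate_succ_apply, S.iterate_succ_apply, ← heq]
      omega
    · obtain ⟨j, hj1, hj2, hj3⟩ := S.exists_mismatch n heq
      have : x + B ≤ f^[n] (a + k) + j := by
        by_contra! hlt'
        have := hB (f^[n] (a + k) + j - x) (by omega)
        refine hj3 ?_
        rw [hXY]
        convert this using 2 <;> omega
      omega
  refine ⟨n, a, b, k, by omega, hab, hk2, hk1, hright.1, hright.2, ?_⟩
  rcases Nat.eq_zero_or_pos a with h0 | h0
  · rw [h0, S.iterate_zero']; exact Or.inl (Nat.zero_le _)
  right
  obtain ⟨a', ha'⟩ := Nat.exists_eq_add_of_le' h0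
  rw [ha', S.iterate_succ_apply] at ha1 ha2 hab
  rw [S.iterate_succ_apply] at hab
  -- If the letters before the two boundaries agree, the previous boundary would either lie in the
  -- stretch, against the choice of `a`, or the repetition would extend to the left of `x`.
  have hne : u a' ≠ u b := by
    intro heq
    rw [← heq] at hab
    have h1 : f^[n] a' < x := by
      by_contra! hle
      exact hmin a' (by omega) ⟨b, hle, by omega, by omega⟩
    refine hleft (x - 1) (by omega) ?_
    have h2 := S.image_of_letter n heq (x - 1 - f^[n] a') (by omega)
    convert h2 using 2 <;> omega
  refine ⟨a', ha', hne, ?_⟩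
  obtain ⟨X, Y, h1, h2, h3, h4⟩ := S.commonSuffix_spec hz n hne
  rw [S.iterate_succ_apply] at h1 h2
  rw [ha', S.iterate_succ_apply]
  by_contra! hgt
  refine h4 ?_
  have h5 := hB (X - x) (by omega)
  convert h5 using 2 <;> omega

/-- The base word occupies positions `a` to `b`. A nonzero letter in it stops the matching zeros
before one full period, which leaves the left extension to be bounded by a common suffix. Otherwise
the base word and the zeros after it form a run inside a single image, so that `φ^n` of run and next
letter is at most as long as `φ^{n+1}(0)`; this gives the first alternative. -/
theorem repetition_bound_of_left_maximal (S : ParrySystem t m p u f β r)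
    (hz : IsLeftLetter t m p u z) {x q B : ℕ} (hq : 1 ≤ q)
    (hB : ∀ j < B, u (x + j) = u (x + q + j)) (hleft : ∀ y, x = y + 1 → u y ≠ u (y + q)) :
    (∃ n q', 1 ≤ q' ∧ q' ≤ t 1 ∧ q = q' * blockLen t m p n 0 ∧
      B + q + 1 ≤ t 1 * blockLen t m p n 0 + blockLen t m p n 1 + zWordLen t m p z n) ∨
    (B < 3 * q ∧ (¬ p ∣ z → B < 2 * q)) := by
  have hm1 := S.m_pos
  have hp1 := S.p_pos
  obtain ⟨n, a, b, k, hle, hab, hk, hk', hr1, hr2, hl⟩ := S.exists_desubstitution hz hq hB hleft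
  by_cases hw : ∃ i, a ≤ i ∧ i < b + 1 ∧ u i ≠ 0
  · right
    obtain ⟨i, hi1, hi2, hi3⟩ := hw
    have hkb : a + k + 1 ≤ b + 1 := by
      by_contra! h
      have := (hk (i - a) (by omega)).1
      rw [Nat.add_sub_cancel' hi1] at this
      exact hi3 this
    have h1 := (S.iterate_strictMono n).monotone hkb
    rw [S.iterate_succ_apply] at h1
    rcases hl with hl | ⟨a', -, hne, hl⟩
    · exact ⟨by omega, fun _ => by omega⟩
    have h2 : f^[n] a ≤ f^[n] b := (S.iterate_strictMono n).monotone hle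
    have h3 := S.iterate_succ_apply n b
    rcases S.commonSuffixLen_le z n (S.u_lt a') (S.u_lt b) hne with h | ⟨N, h4, h5⟩
    · rw [h] at hl
      exact ⟨by omega, fun _ => by omega⟩
    · rw [h4] at hl
      by_cases hpz : p ∣ z
      · have h6 := S.zWordLen_le_zeroBlockLen hz hpz N
        rw [S.commonSuffixLen_z hz.ne_zero hz.lt hpz] at hl
        exact ⟨by omega, fun h => absurd hpz h⟩
      · rw [S.commonSuffixLen_eq_zero z N (by omega) hz.lt
          (fun h => hpz (Nat.modEq_zero_iff_dvd.1 h.symm))] at hl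
        exact ⟨by omega, fun _ => by omega⟩
  · left
    push Not at hw
    have hrun : ∀ j < (b + 1 - a) + k, u (a + j) = 0 := fun j hj => by
      by_cases h : j < b + 1 - a
      · exact hw _ (by omega) (by omega)
      · have := (hk (j - (b + 1 - a)) (by omega)).2
        rwa [show b + 1 + (j - (b + 1 - a)) = a + j by omega] at this
    have hX : u (a + k) = 0 := hrun k (by omega)
    have hY : u (b + 1 + k) ≠ 0 := fun h => hk' ⟨hX, h⟩
    have hY' : a + ((b + 1 - a) + k) = b + 1 + k := by omega
    obtain ⟨e, he1, he2, -⟩ := S.exists_of_zero_run hrun (by rwa [hY'])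
    rw [hY'] at he1
    have h1 := S.digit_le (u e)
    have h2 := S.iterate_add_zeros n (x := a) (j := b + 1 - a)
      (fun i hi => hrun i (by omega))
    rw [show a + (b + 1 - a) = b + 1 by omega, hab] at h2
    have h3 := S.iterate_add_zeros n (x := a) (j := k) (fun i hi => hrun i (by omega))
    refine ⟨n, b + 1 - a, by omega, by omega, by omega, ?_⟩
    have h4 := S.blockLen_le_zero (n + 1) (S.u_lt e)
    have h5 : blockLen t m p (n + 1) 0 = t 1 * blockLen t m p n 0 + blockLen t m p n 1 := by
      simp only [blockLen, zero_add, nxt_eq_add_one (show 0 + 1 < m + p by omega)]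
    have h6 := Nat.mul_le_mul_right (blockLen t m p n 0) he2
    have h7 : blockLen t m p (n + 1) (u e) =
      t (u e + 1) * blockLen t m p n 0 + blockLen t m p n (nxt m p (u e)) := rfl
    rw [add_mul] at h6
    rw [he1] at hr2
    have h8 : f^[n] a ≤ x + zWordLen t m p z n := by
      rcases hl with hl | ⟨a', -, hne, hl⟩
      · omega
      · rw [hw b hle (by omega)] at hl hne
        exact hl.trans (Nat.add_le_add_left
          (S.commonSuffixLen_le_zWordLen hz.ne_zero hz.lt n hne (S.u_lt a')) _)
    omega

/-- A repetition with period `q` and length `q + B` either is short, or its length is bounded by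
that of the maximal repetition with period `|φ^n(0)|`. -/
theorem repetition_bound (S : ParrySystem t m p u f β r) (hz : IsLeftLetter t m p u z)
    {x q B : ℕ} (hq : 1 ≤ q) (hB : ∀ j < B, u (x + j) = u (x + q + j)) :
    (∃ n q', 1 ≤ q' ∧ q' ≤ t 1 ∧ q = q' * blockLen t m p n 0 ∧
      B + q + 1 ≤ t 1 * blockLen t m p n 0 + blockLen t m p n 1 + zWordLen t m p z n) ∨
    (B < 3 * q ∧ (¬ p ∣ z → B < 2 * q)) := by
  induction x generalizing B with
  | zero => exact S.repetition_bound_of_left_maximal hz hq hB (by omega)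
  | succ x ih =>
    by_cases h : u x = u (x + q)
    · rcases ih (B := B + 1) (fun j hj => by
        rcases Nat.eq_zero_or_pos j with rfl | hj0
        · exact h
        · have := hB (j - 1) (by omega)
          convert this using 2 <;> omega) with ⟨n, q', h1, h2, h3, h4⟩ | ⟨h1, h2⟩
      · exact Or.inl ⟨n, q', h1, h2, h3, by omega⟩
      · exact Or.inr ⟨by omega, fun h => by have := h2 h; omega⟩
    · refine S.repetition_bound_of_left_maximal hz hq hB fun y hy => ?_
      obtain rfl : x = y := by omega
      exact h

/-! ### The maximal repetition occurs -/

/-- `φ^j(0)` ends in `j` and is followed in `u` by `φ^j(0)` again, as `u` begins with `00`. In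
particular every letter occurs, followed by `0`. -/
theorem u_iterate_one (S : ParrySystem t m p u f β r) {j : ℕ} (hj : j < m + p) :
    ∃ y, f^[j] 1 = y + 1 ∧ u y = j ∧ u (y + 1) = 0 := by
  have h3 := S.three_le
  induction j with
  | zero =>
    refine ⟨0, rfl, S.u_zero, ?_⟩
    have := S.u_zeros 0 1 (by rw [S.u_zero, zero_add]; omega)
    rwa [S.f_zero] at this
  | succ j ih =>
    obtain ⟨y, h1, h2, h4⟩ := ih (by omega)
    rw [Function.iterate_succ_apply', h1]
    refine ⟨f y + t (u y + 1), S.f_succ y, ?_, ?_⟩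
    · rw [S.u_last, h2, nxt_eq_add_one hj]
    · have := S.u_zeros (y + 1) 0 (by rw [h4, zero_add]; omega)
      rwa [add_zero, S.f_succ] at this

/-- The maximal repetition with period `|φ^n(0)|`. -/
theorem exists_repetition (S : ParrySystem t m p u f β r) (hz : IsLeftLetter t m p u z) (n : ℕ) :
    ∃ x B, (∀ j < B, u (x + j) = u (x + blockLen t m p n 0 + j)) ∧
      B + blockLen t m p n 0 + 1 =
        t 1 * blockLen t m p n 0 + blockLen t m p n 1 + zWordLen t m p z n := by
  have hm1 := S.m_pos
  have hp1 := S.p_pos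
  have ht := S.three_le
  -- The repetition comes from the factor `p 0^{t_1} 1`, the end of the image of `(p-1) 0`. Under
  -- `φ^n`, the letter `p` shares the suffix `z^{(n)}` with `0`, and `1` contributes its image
  -- without the last letter, by `image_prefix`.
  obtain ⟨a, ha1, ha2, ha3⟩ := S.u_iterate_one (j := p) (by omega)
  obtain ⟨p', hp'⟩ := Nat.exists_eq_add_of_le' hp1
  obtain ⟨c, hc1, hc2, hc3⟩ := S.u_iterate_one (j := p') (by omega)
  rw [hp', Function.iterate_succ_apply', hc1] at ha1
  have hzero : ∀ j < t 1, u (a + 1 + j) = 0 := fun j hj => by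
    rw [← ha1]; exact S.u_zeros (c + 1) j (by rwa [hc3, zero_add])
  have hone : u (a + 1 + t 1) = 1 := by
    have := S.u_last (c + 1)
    rwa [hc3, zero_add, ha1, nxt_eq_add_one (by omega)] at this
  obtain ⟨X, Y, h1, h2, h3, -⟩ := S.commonSuffix_spec hz n (x := a) (y := a + 1)
    (by rw [ha2, ha3]; omega)
  rw [ha2, ha3, commonSuffixLen_comm,
    S.commonSuffixLen_eq_zWordLen hz.ne_zero hz.lt n (by omega) (by omega) dvd_rfl] at h1 h2 h3
  have h4 := S.iterate_succ_apply n (a + 1)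
  rw [ha3] at h4
  have h5 := S.image_of_match n (a := a + 1) (b := a + 1 + 1) (k := t 1 - 1) (fun j hj => by
    have := hzero (j + 1) (by omega)
    rw [hzero j (by omega), ← this]; congr 1; omega)
  have h6 := S.iterate_add_zeros n (x := a + 1) (j := t 1 - 1)
    (fun i hi => hzero i (by omega))
  have h7 := S.iterate_add_zeros n hzero
  have h8 := S.image_prefix n (a := a + 1 + t 1) (b := a + 1 + (t 1 - 1)) (by
    rw [hone, hzero _ (by omega), S.rem_zero]; exact S.rem_le_one 1)
  rw [hone] at h8
  have hpos := blockLen_pos t m p n 1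
  set U := blockLen t m p n 0
  set Z := zWordLen t m p z n
  have hU : t 1 * U = (t 1 - 1) * U + U := by
    rw [← Nat.succ_mul]; congr 1; omega
  refine ⟨X + 1, Z + (t 1 - 1) * U + (blockLen t m p n 1 - 1), fun j hj => ?_, by omega⟩
  by_cases hj1 : j < Z
  · rw [h3 j hj1]; congr 1; omega
  by_cases hj2 : j < Z + (t 1 - 1) * U
  · have := h5.2 (j - Z) (by omega)
    convert this using 2 <;> omega
  · have := (h8 (j - (Z + (t 1 - 1) * U)) (by omega)).symm
    convert this using 2 <;> omega

end ParrySystem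

/-! ### Limits of averaging processes and of affine recurrences -/

open Filter Topology

theorem averaging_lower {M : ℕ} {g : ℕ → ℕ → ℝ} {w : ℕ → ℝ} {σ : ℕ → ℕ}
    (hσ : ∀ a < M, σ a < M) (hw0 : ∀ a < M, 0 ≤ w a) (hw1 : ∀ a < M, w a ≤ 1)
    (hg : ∀ n, ∀ a < M, g (n + 1) a = w a * g n 0 + (1 - w a) * g n (σ a)) (hM : 0 < M)
    {A : ℝ} {n : ℕ} (hA : ∀ a < M, A ≤ g n a) (k : ℕ) : ∀ a < M, A ≤ g (n + k) a := by
  induction k with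
  | zero => exact hA
  | succ k ih =>
    intro a ha
    rw [← add_assoc, hg _ a ha]
    nlinarith [ih 0 hM, ih _ (hσ a ha), hw0 a ha, hw1 a ha,
      mul_le_mul_of_nonneg_left (ih 0 hM) (hw0 a ha),
      mul_le_mul_of_nonneg_left (ih _ (hσ a ha)) (sub_nonneg.2 (hw1 a ha))]

/-- If the state `0` exceeds a lower bound, then the other states do so after some steps. -/
theorem averaging_improve {M : ℕ} {g : ℕ → ℕ → ℝ} {w : ℕ → ℝ} {σ : ℕ → ℕ}
    (hσ : ∀ a < M, σ a < M) (hw0 : ∀ a < M, 0 ≤ w a) (hw1 : ∀ a < M, w a ≤ 1)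
    (hg : ∀ n, ∀ a < M, g (n + 1) a = w a * g n 0 + (1 - w a) * g n (σ a)) (hM : 0 < M)
    {A E δ : ℝ} {n : ℕ} (hA : ∀ a < M, A ≤ g n a) (hE : 0 ≤ E) (h0 : A + E ≤ g n 0)
    (hδ0 : 0 < δ) (hδ1 : δ ≤ 1) (hδ : ∀ a < M, 0 < w a → δ ≤ w a) (hw : 0 < w 0)
    (k : ℕ) : ∀ a < M, 0 < w (σ^[k] a) → ∀ j, k < j → A + δ ^ j * E ≤ g (n + j) a := by
  have hlow := averaging_lower hσ hw0 hw1 hg hM hA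
  have hstep : ∀ a < M, δ ≤ w a → ∀ j, A + δ ^ j * E ≤ g (n + j) 0 →
      A + δ ^ (j + 1) * E ≤ g (n + (j + 1)) a := by
    intro a ha hwa j hj
    rw [← add_assoc, hg _ a ha]
    have h1 : 0 ≤ δ ^ j * E := by positivity
    have h2 := mul_le_mul_of_nonneg_left hj (hw0 a ha)
    have h3 := mul_le_mul_of_nonneg_left (hlow j _ (hσ a ha)) (sub_nonneg.2 (hw1 a ha))
    have h4 := mul_le_mul_of_nonneg_right hwa h1
    rw [pow_succ]
    nlinarith
  have hzero : ∀ j, A + δ ^ j * E ≤ g (n + j) 0 := by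
    intro j
    induction j with
    | zero => simpa using h0
    | succ j ih => exact hstep 0 hM (hδ 0 hM hw) j ih
  have hpos : ∀ a < M, 0 < w a → ∀ j, 0 < j → A + δ ^ j * E ≤ g (n + j) a := by
    intro a ha hwa j hj
    obtain ⟨i, rfl⟩ := Nat.exists_eq_add_of_le' hj
    exact hstep a ha (hδ a ha hwa) i (hzero i)
  induction k with
  | zero => exact hpos
  | succ k ih =>
    intro a ha hwa j hj
    obtain ⟨i, rfl⟩ := Nat.exists_eq_add_of_le' (show 1 ≤ j by omega)
    rcases (hw0 a ha).eq_or_lt with h | h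
    · have h1 := ih _ (hσ a ha) (by rwa [Function.iterate_succ_apply] at hwa) i (by omega)
      rw [← add_assoc, hg _ a ha, ← h]
      have h2 : δ ^ (i + 1) * E ≤ δ ^ i * E := by
        apply mul_le_mul_of_nonneg_right _ hE
        exact pow_le_pow_of_le_one hδ0.le hδ1 (Nat.le_succ i)
      linarith
    · exact hpos a ha h _ (by omega)

/-- Convergence to a constant under repeated averaging with a state that is always reached. -/
theorem exists_tendsto_of_averaging {M : ℕ} {g : ℕ → ℕ → ℝ} {w : ℕ → ℝ} {σ : ℕ → ℕ}
    (hσ : ∀ a < M, σ a < M) (hw0 : ∀ a < M, 0 ≤ w a) (hw1 : ∀ a < M, w a ≤ 1)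
    (hg : ∀ n, ∀ a < M, g (n + 1) a = w a * g n 0 + (1 - w a) * g n (σ a)) (hM : 0 < M)
    (hw : 0 < w 0) (hhit : ∀ a < M, ∃ k, 0 < w (σ^[k] a)) :
    ∃ c, (∀ a < M, Tendsto (fun n => g n a) atTop (𝓝 c)) ∧
      ∀ A, (∀ a < M, A ≤ g 0 a) → A ≤ c := by
  have hne : (Finset.range M).Nonempty := ⟨0, Finset.mem_range.2 hM⟩
  set lo : ℕ → ℝ := fun n => (Finset.range M).inf' hne (g n) with hlo
  set hi : ℕ → ℝ := fun n => (Finset.range M).sup' hne (g n) with hhi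
  have hlo1 : ∀ n, ∀ a < M, lo n ≤ g n a := fun n a ha =>
    Finset.inf'_le _ (Finset.mem_range.2 ha)
  have hhi1 : ∀ n, ∀ a < M, g n a ≤ hi n := fun n a ha =>
    Finset.le_sup' (f := g n) (Finset.mem_range.2 ha)
  have hlo2 : ∀ n A, (∀ a < M, A ≤ g n a) → A ≤ lo n := fun n A h =>
    Finset.le_inf' _ _ fun a ha => h a (Finset.mem_range.1 ha)
  have hhi2 : ∀ n A, (∀ a < M, g n a ≤ A) → hi n ≤ A := fun n A h =>
    Finset.sup'_le _ _ fun a ha => h a (Finset.mem_range.1 ha)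
  have hg' : ∀ n, ∀ a < M, (fun n a => - g n a) (n + 1) a =
      w a * (fun n a => - g n a) n 0 + (1 - w a) * (fun n a => - g n a) n (σ a) := by
    intro n a ha
    simp only [hg n a ha]; ring
  have hmono : Monotone lo := monotone_nat_of_le_succ fun n =>
    hlo2 _ _ (averaging_lower hσ hw0 hw1 hg hM (hlo1 n) 1)
  have hanti : Antitone hi := antitone_nat_of_succ_le fun n =>
    hhi2 _ _ fun a ha => by
      have := averaging_lower (g := fun n a => - g n a) (A := - hi n) hσ hw0 hw1 hg' hM
        (fun a ha => neg_le_neg (hhi1 n a ha)) 1 a ha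
      exact neg_le_neg_iff.1 this
  have hle : ∀ n, lo n ≤ hi n := fun n => (hlo1 n 0 hM).trans (hhi1 n 0 hM)
  have hclo : Tendsto lo atTop (𝓝 (⨆ n, lo n)) := tendsto_atTop_ciSup hmono
    ⟨hi 0, by rintro _ ⟨n, rfl⟩; exact (hle n).trans (hanti (Nat.zero_le n))⟩
  have hchi : Tendsto hi atTop (𝓝 (⨅ n, hi n)) := tendsto_atTop_ciInf hanti
    ⟨lo 0, by rintro _ ⟨n, rfl⟩; exact (hmono (Nat.zero_le n)).trans (hle n)⟩
  set c := ⨆ n, lo n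
  set c' := ⨅ n, hi n
  -- `δ` is the smallest positive weight; zero weights are replaced by `1` so as not to affect the
  -- minimum.
  obtain ⟨δ, hδ0, hδ1, hδ⟩ : ∃ δ : ℝ, 0 < δ ∧ δ ≤ 1 ∧ ∀ a < M, 0 < w a → δ ≤ w a := by
    refine ⟨(Finset.range M).inf' hne (fun a => if 0 < w a then w a else 1), ?_, ?_, ?_⟩
    · rw [Finset.lt_inf'_iff]
      intro a _
      split_ifs with h
      · exact h
      · exact one_pos
    · refine (Finset.inf'_le _ (Finset.mem_range.2 hM)).trans ?_
      simp only [if_pos hw]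
      exact hw1 0 hM
    · intro a ha hwa
      refine (Finset.inf'_le _ (Finset.mem_range.2 ha)).trans ?_
      simp only [if_pos hwa]; exact le_rfl
  obtain ⟨N, hN⟩ : ∃ N, ∀ a < M, ∃ k < N, 0 < w (σ^[k] a) := by
    choose! κ hκ using hhit
    refine ⟨(Finset.range M).sup κ + 1, fun a ha => ⟨κ a, ?_, hκ a ha⟩⟩
    exact Nat.lt_succ_of_le (Finset.le_sup (Finset.mem_range.2 ha))
  have hcontr : ∀ n, hi (n + N) - lo (n + N) ≤ (1 - δ ^ N / 2) * (hi n - lo n) := by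
    intro n
    have hE : 0 ≤ (hi n - lo n) / 2 := by linarith [hle n]
    -- State `0` lies in the upper or the lower half of the range. Within `N` steps it pulls up the
    -- minimum or pulls down the maximum.
    rcases le_total (lo n + (hi n - lo n) / 2) (g n 0) with h | h
    · have h1 : lo n + δ ^ N * ((hi n - lo n) / 2) ≤ lo (n + N) := hlo2 _ _ fun a ha => by
        obtain ⟨k, hk, hk'⟩ := hN a ha
        exact averaging_improve hσ hw0 hw1 hg hM (hlo1 n) hE h hδ0 hδ1 hδ hw k a ha hk' N hk
      have h2 := hanti (Nat.le_add_right n N)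
      linarith
    · have h1 : hi (n + N) ≤ hi n - δ ^ N * ((hi n - lo n) / 2) := hhi2 _ _ fun a ha => by
        obtain ⟨k, hk, hk'⟩ := hN a ha
        have := averaging_improve (g := fun n a => - g n a) (A := - hi n) hσ hw0 hw1 hg' hM
          (fun a ha => neg_le_neg (hhi1 n a ha)) hE (by linarith) hδ0 hδ1 hδ hw k a ha
          hk' N hk
        linarith
      have h2 := hmono (Nat.le_add_right n N)
      linarith
  have hcc : c' - c ≤ (1 - δ ^ N / 2) * (c' - c) :=
    le_of_tendsto_of_tendsto' ((tendsto_add_atTop_iff_nat N).2 (hchi.sub hclo))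
      ((hchi.sub hclo).const_mul _) hcontr
  have hcc2 : 0 ≤ c' - c := ge_of_tendsto' (hchi.sub hclo) fun n => sub_nonneg.2 (hle n)
  have hcc3 : c' = c := by
    have : 0 < δ ^ N / 2 := by positivity
    nlinarith
  refine ⟨c, fun a ha => ?_, fun A hA => ?_⟩
  · exact tendsto_of_tendsto_of_tendsto_of_le_of_le hclo (hcc3 ▸ hchi) (fun n => hlo1 n a ha)
      (fun n => hhi1 n a ha)
  · exact ge_of_tendsto' hclo fun n => (hlo2 0 A hA).trans (hmono (Nat.zero_le n))

/-- The distance to the fixed point of `x ↦ ρ x + H` shrinks by `ρ` every `m` steps, up to an error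
controlled by `h - H`. -/
theorem tendsto_of_affine_rec {ζ h : ℕ → ℝ} {ρ H C : ℝ} {m : ℕ} (hρ0 : 0 ≤ ρ) (hρ1 : ρ < 1)
    (hrec : ∀ n, ζ (n + m) = ρ * ζ n + h n) (hh : Tendsto h atTop (𝓝 H))
    (hC : ∀ n, |ζ n| ≤ C) : Tendsto ζ atTop (𝓝 (H / (1 - ρ))) := by
  have hρ : 0 < 1 - ρ := by linarith
  set L := H / (1 - ρ) with hL
  have hLH : L = ρ * L + H := by rw [hL]; field_simp; ring
  rw [Metric.tendsto_atTop] at hh ⊢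
  intro ε hε
  obtain ⟨N, hN⟩ := hh (ε / 2 * (1 - ρ)) (by positivity)
  have hC' : ∀ n, |ζ n - L| ≤ C + |L| := fun n =>
    (abs_sub _ _).trans (by linarith [hC n])
  have key : ∀ k n, N + k * m ≤ n → |ζ n - L| ≤ (C + |L|) * ρ ^ k + ε / 2 := by
    intro k
    induction k with
    | zero => intro n _; rw [pow_zero, mul_one]; linarith [hC' n]
    | succ k ih =>
      intro n hn
      rw [add_mul, one_mul] at hn
      obtain ⟨i, rfl⟩ := Nat.exists_eq_add_of_le' (show m ≤ n by omega)
      have h1 := ih i (by omega)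
      have h2 : |h i - H| < ε / 2 * (1 - ρ) := by
        have := hN i (by nlinarith [Nat.zero_le (k * m)])
        rwa [Real.dist_eq] at this
      have h3 : ζ (i + m) - L = ρ * (ζ i - L) + (h i - H) := by
        rw [hrec]; linarith
      rw [h3]
      have h4 : |ρ * (ζ i - L)| = ρ * |ζ i - L| := by rw [abs_mul, abs_of_nonneg hρ0]
      have h5 := mul_le_mul_of_nonneg_left h1 hρ0
      calc |ρ * (ζ i - L) + (h i - H)| ≤ |ρ * (ζ i - L)| + |h i - H| := abs_add_le _ _
        _ ≤ _ := by rw [h4, pow_succ]; nlinarith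
  have hlim : Tendsto (fun k => (C + |L|) * ρ ^ k) atTop (𝓝 ((C + |L|) * 0)) :=
    (tendsto_pow_atTop_nhds_zero_of_lt_one hρ0 hρ1).const_mul _
  rw [mul_zero] at hlim
  obtain ⟨k, hk⟩ := (hlim.eventually_lt_const (half_pos hε)).exists
  refine ⟨N + k * m, fun n hn => ?_⟩
  rw [Real.dist_eq]
  linarith [key k n hn]

/-! ### Growth of images and the limit of the exponents -/

namespace ParrySystem

variable {t : ℕ → ℕ} {m p : ℕ} {u f : ℕ → ℕ} {β : ℝ} {r : ℕ → ℝ} {z : ℕ}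

theorem iterate_nxt {a k : ℕ} (h : a + k < m + p) : (nxt m p)^[k] a = a + k := by
  induction k with
  | zero => rfl
  | succ k ih =>
    rw [Function.iterate_succ_apply', ih (by omega), nxt_eq_add_one (by omega)]; rfl

/-- Every letter reaches `m + p - 1`, then `m`, and then runs through the period, which has a
nonzero digit. -/
theorem exists_iterate_nxt (S : ParrySystem t m p u f β r) {a : ℕ} (ha : a < m + p) :
    ∃ k, 0 < t ((nxt m p)^[k] a + 1) := by
  obtain ⟨i, hi1, hi2, hi3⟩ := S.exists_digit_pos
  refine ⟨(i - 1 - m) + 1 + (m + p - 1 - a), ?_⟩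
  rw [Function.iterate_add_apply, iterate_nxt (a := a) (by omega), Function.iterate_add_apply,
    show a + (m + p - 1 - a) = m + p - 1 by omega, Function.iterate_one,
    show nxt m p (m + p - 1) = m by unfold nxt; rw [if_neg (by omega)], iterate_nxt (by omega),
    show m + (i - 1 - m) + 1 = i by omega]
  exact hi3

/-- The lengths of the images of letters grow like `β^n`. -/
theorem exists_tendsto_blockLen (S : ParrySystem t m p u f β r) : ∃ c, 0 < c ∧ ∀ a < m + p,
    Tendsto (fun n => (blockLen t m p n a : ℝ) / β ^ n) atTop (𝓝 (c * r a)) := by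
  have hm1 := S.m_pos
  have hβ : 0 < β := by linarith [S.one_lt]
  have hpos : ∀ a, 0 < β * r a := fun a => mul_pos hβ (S.rem_pos a)
  -- Dividing by `β^n r_a` turns the length recurrence into an average, because `t (a + 1)` and `r
  -- (nxt m p a)` add up to `β * r a`. At `n = 0` the values `1 / r a` are at least `1`, so the
  -- limit is positive.
  obtain ⟨c, hc1, hc2⟩ := exists_tendsto_of_averaging (M := m + p) (σ := nxt m p)
    (g := fun n a => (blockLen t m p n a : ℝ) / (β ^ n * r a))
    (w := fun a => t (a + 1) / (β * r a)) (fun a _ => nxt_lt S.p_pos a)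
    (fun a _ => div_nonneg (Nat.cast_nonneg _) (hpos a).le)
    (fun a ha => by
      rw [div_le_one (hpos a), S.rem_nxt ha]
      linarith [S.rem_pos (nxt m p a)])
    (fun n a ha => by
      have h1 := S.rem_nxt ha
      have h2 : 1 - t (a + 1) / (β * r a) = r (nxt m p a) / (β * r a) := by
        rw [eq_div_iff (hpos a).ne', sub_mul, div_mul_cancel₀ _ (hpos a).ne']
        linarith
      have h3 := (S.rem_pos (nxt m p a)).ne'
      have h4 := (S.rem_pos a).ne'
      rw [h2, S.rem_zero, blockLen]
      push_cast
      field_simp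
      ring)
    (by omega)
    (div_pos (by have := S.three_le; simp only [zero_add, Nat.cast_pos]; omega) (hpos 0))
    (fun a ha => by
      obtain ⟨k, hk⟩ := S.exists_iterate_nxt ha
      exact ⟨k, div_pos (by exact_mod_cast hk) (hpos _)⟩)
  refine ⟨c, lt_of_lt_of_le one_pos (hc2 1 fun a _ => ?_), fun a ha => ?_⟩
  · simp only [blockLen, Nat.cast_one, pow_zero, one_mul]
    rw [le_div_iff₀ (S.rem_pos a), one_mul]
    exact S.rem_le_one a
  · refine ((hc1 a ha).mul_const (r a)).congr fun n => ?_
    have := (S.rem_pos a).ne'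
    field_simp

/-- The exponent of the maximal repetition with period `|φ^n(0)|`. -/
noncomputable def _root_.ParryWord.maxExponent (t : ℕ → ℕ) (m p z n : ℕ) : ℝ :=
  t 1 + ((zWordLen t m p z n : ℝ) + blockLen t m p n 1 - 1) / blockLen t m p n 0

theorem tendsto_maxExponent_aux (S : ParrySystem t m p u f β r) {c ξ : ℝ} (hc : 0 < c)
    (h : ∀ a < m + p, Tendsto (fun n => (blockLen t m p n a : ℝ) / β ^ n) atTop (𝓝 (c * r a)))
    (hz : Tendsto (fun n => (zWordLen t m p z n : ℝ) / β ^ n) atTop (𝓝 (c * ξ))) :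
    Tendsto (maxExponent t m p z) atTop (𝓝 (β + ξ)) := by
  have hm1 := S.m_pos
  have hp1 := S.p_pos
  have hβ : 0 < β := by linarith [S.one_lt]
  have h1 : Tendsto (fun n : ℕ => 1 / β ^ n) atTop (𝓝 0) := by
    simpa [one_div, inv_pow] using
      tendsto_pow_atTop_nhds_zero_of_lt_one (inv_nonneg.2 hβ.le) (inv_lt_one_of_one_lt₀ S.one_lt)
  have h2 := (((hz.add (h 1 (by omega))).sub h1).div (h 0 (by omega))
    (by rw [S.rem_zero]; simpa using hc.ne')).const_add (t 1 : ℝ)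
  have h3 := S.rem_succ 0
  rw [S.rem_zero, zero_add, mul_one] at h3
  have h4 : (t 1 : ℝ) + (c * ξ + c * r 1 - 0) / (c * r 0) = β + ξ := by
    rw [S.rem_zero, h3]; field_simp; ring
  rw [h4] at h2
  refine h2.congr fun n => ?_
  have h5 : (blockLen t m p n 0 : ℝ) ≠ 0 := by exact_mod_cast (blockLen_pos t m p n 0).ne'
  simp only [maxExponent, Pi.div_apply]
  field_simp

theorem tendsto_zeroBlockLen (S : ParrySystem t m p u f β r) {c : ℝ}
    (h : ∀ a < m + p, Tendsto (fun n => (blockLen t m p n a : ℝ) / β ^ n) atTop (𝓝 (c * r a))) :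
    Tendsto (fun n => (zeroBlockLen t m p n : ℝ) / β ^ n) atTop
      (𝓝 (c * (tMin t m p + r m))) := by
  have hm1 := S.m_pos
  have hp1 := S.p_pos
  have h1 := ((h 0 (by omega)).const_mul (tMin t m p : ℝ)).add (h m (by omega))
  rw [S.rem_zero, show (tMin t m p : ℝ) * (c * 1) + c * r m = c * (tMin t m p + r m) by ring] at h1
  refine h1.congr fun n => ?_
  simp only [zeroBlockLen]
  push_cast
  ring

theorem tendsto_maxExponent_of_not_dvd (S : ParrySystem t m p u f β r) (hpz : ¬ p ∣ z) :
    Tendsto (maxExponent t m p z) atTop (𝓝 (β + 1 / β ^ m * (tMin t m p + r m))) := by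
  obtain ⟨c, hc, h⟩ := S.exists_tendsto_blockLen
  have hβ : 0 < β := by linarith [S.one_lt]
  refine S.tendsto_maxExponent_aux hc h ?_
  rw [← tendsto_add_atTop_iff_nat m]
  have h1 := (S.tendsto_zeroBlockLen h).const_mul (1 / β ^ m)
  rw [show c * (1 / β ^ m * (tMin t m p + r m)) = 1 / β ^ m * (c * (tMin t m p + r m)) by ring]
  refine h1.congr fun n => ?_
  rw [zWordLen, if_neg (by omega), if_neg hpz, Nat.add_sub_cancel, pow_add]
  field_simp

theorem tendsto_maxExponent_of_dvd (S : ParrySystem t m p u f β r) (hz0 : z ≠ 0)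
    (hz : z < m + p) (hpz : p ∣ z) :
    Tendsto (maxExponent t m p z) atTop (𝓝 (β + 1 / (β ^ m - 1) * (tMin t m p + r m))) := by
  obtain ⟨c, hc, h⟩ := S.exists_tendsto_blockLen
  have hm1 := S.m_pos
  have hβ : 0 < β := by linarith [S.one_lt]
  have hβm : 1 < β ^ m := one_lt_pow₀ S.one_lt (by omega)
  refine S.tendsto_maxExponent_aux hc h ?_
  have h0 := h 0 (by omega)
  obtain ⟨C, hC⟩ := h0.bddAbove_range
  have h1 := tendsto_of_affine_rec (m := m) (ρ := 1 / β ^ m) (C := C)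
    (ζ := fun n => (zWordLen t m p z n : ℝ) / β ^ n)
    (h := fun n => 1 / β ^ m * (zeroBlockLen t m p n / β ^ n)) (by positivity)
    (by rw [div_lt_one (by positivity)]; exact hβm)
    (fun n => by
      rw [S.zWordLen_add hz0 hz hpz, pow_add]; push_cast; field_simp; ring)
    ((S.tendsto_zeroBlockLen h).const_mul _)
    (fun n => by
      rw [abs_of_nonneg (by positivity)]
      refine le_trans ?_ (hC ⟨n, rfl⟩)
      have := S.zWordLen_le_blockLen hz0 hz hpz n
      simp only
      gcongr)
  convert h1 using 2
  have h2 : β ^ m - 1 ≠ 0 := by linarith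
  have h3 : 1 - 1 / β ^ m ≠ 0 := by
    rw [sub_ne_zero]; intro h
    rw [eq_div_iff (by positivity)] at h; linarith
  field_simp

end ParrySystem

/-! ### The Rényi expansion -/

theorem renyiRem_nonneg (β : ℝ) (a : ℕ) : 0 ≤ renyiRem β a := by
  cases a with
  | zero => simp [renyiRem]
  | succ a => exact Int.fract_nonneg _

theorem renyiRem_succ_lt (β : ℝ) (a : ℕ) : renyiRem β (a + 1) < 1 := Int.fract_lt_one _

theorem renyiRem_le_one (β : ℝ) (a : ℕ) : renyiRem β a ≤ 1 := by
  cases a with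
  | zero => simp [renyiRem]
  | succ a => exact (renyiRem_succ_lt β a).le

theorem mul_renyiRem {β : ℝ} (hβ : 1 < β) (a : ℕ) :
    β * renyiRem β a = renyiDigit β (a + 1) + renyiRem β (a + 1) := by
  have h : 0 ≤ β * renyiRem β a := mul_nonneg (by linarith) (renyiRem_nonneg β a)
  rw [renyiDigit, Nat.add_sub_cancel, renyiRem, natCast_floor_eq_intCast_floor h,
    Int.floor_add_fract]

theorem renyiRem_eq_sum {β : ℝ} (hβ : 1 < β) (k n : ℕ) : renyiRem β k =
    ∑ i ∈ Finset.range n, (renyiDigit β (i + 1 + k) : ℝ) / β ^ (i + 1) +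
      renyiRem β (n + k) / β ^ n := by
  have hβ0 : 0 < β := by linarith
  induction n with
  | zero => simp
  | succ n ih =>
    rw [ih, Finset.sum_range_succ, add_assoc]
    congr 1
    have h := mul_renyiRem hβ (n + k)
    rw [show n + k + 1 = n + 1 + k by ring] at h
    rw [← add_div, ← h, pow_succ]
    field_simp

theorem gap_eq_renyiRem {β : ℝ} (hβ : 1 < β) (k : ℕ) : gap β k = renyiRem β k := by
  have hβ0 : 0 < β := by linarith
  refine HasSum.tsum_eq ?_
  rw [hasSum_iff_tendsto_nat_of_nonneg (fun i => by positivity)]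
  have h1 : Tendsto (fun n => renyiRem β (n + k) / β ^ n) atTop (𝓝 0) := by
    have h2 : Tendsto (fun n : ℕ => 1 / β ^ n) atTop (𝓝 0) := by
      simpa [one_div, inv_pow] using
        tendsto_pow_atTop_nhds_zero_of_lt_one (inv_nonneg.2 hβ0.le) (inv_lt_one_of_one_lt₀ hβ)
    refine squeeze_zero (fun n => div_nonneg (renyiRem_nonneg _ _) (by positivity))
      (fun n => ?_) h2
    gcongr
    exact renyiRem_le_one _ _
  have h3 := h1.const_sub (renyiRem β k)
  rw [sub_zero] at h3
  refine h3.congr fun n => ?_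
  have := renyiRem_eq_sum hβ k n
  linarith

namespace IsNonSimpleParry

variable {β : ℝ} {m p : ℕ}

theorem renyiRem_pos (h : IsNonSimpleParry β m p) (a : ℕ) : 0 < renyiRem β a := by
  refine (renyiRem_nonneg β a).lt_of_ne' fun h0 => ?_
  have hz : ∀ n, renyiRem β (a + n) = 0 := fun n => by
    induction n with
    | zero => exact h0
    | succ n ih => rw [← add_assoc, renyiRem, ih, mul_zero, Int.fract_zero]
  obtain ⟨i, hi, hne⟩ := h.not_simple a
  obtain ⟨j, rfl⟩ := Nat.exists_eq_add_of_lt hi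
  refine hne ?_
  rw [renyiDigit, Nat.add_sub_cancel, hz, mul_zero, Nat.floor_zero]

theorem renyiRem_period (h : IsNonSimpleParry β m p) : renyiRem β (m + p) = renyiRem β m := by
  rw [← gap_eq_renyiRem h.one_lt, ← gap_eq_renyiRem h.one_lt]
  unfold gap
  congr 1
  funext i
  rw [← add_assoc, h.periodic _ (by omega)]

/-- Equal digits would give equal remainders at `m - 1` and `m + p - 1`. For `m = 1` this says that
a later remainder equals `1`, which is impossible; for `m > 1` the preperiod could be shortened. -/
theorem digit_ne (h : IsNonSimpleParry β m p) : renyiDigit β m ≠ renyiDigit β (m + p) := by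
  intro heq
  obtain ⟨k, rfl⟩ := Nat.exists_eq_add_of_le' h.m_pos
  have hp := h.p_pos
  have hβ := h.one_lt
  have h1 := mul_renyiRem hβ k
  have h2 := mul_renyiRem hβ (k + p)
  rw [show k + p + 1 = k + 1 + p by ring, ← heq, h.renyiRem_period, ← h1] at h2
  have h3 : renyiRem β (k + p) = renyiRem β k :=
    mul_left_cancel₀ (show β ≠ 0 by linarith) h2
  rcases Nat.eq_zero_or_pos k with rfl | hk
  · obtain ⟨p', rfl⟩ := Nat.exists_eq_add_of_le' hp
    have h4 := renyiRem_succ_lt β p'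
    rw [zero_add] at h3
    rw [h3] at h4
    simp [renyiRem] at h4
  · have h4 := (h.least k p hk hp fun i hi => by
      rcases Nat.lt_or_ge (k + 1) i with h5 | h5
      · exact h.periodic i h5
      · obtain rfl : i = k + 1 := by omega
        exact heq.symm).1
    omega

theorem exists_digit_pos (h : IsNonSimpleParry β m p) :
    ∃ i, m < i ∧ i ≤ m + p ∧ 0 < renyiDigit β i := by
  by_contra! hcon
  have hp := h.p_pos
  have hz : ∀ i, m < i → renyiDigit β i = 0 := by
    intro i
    induction i using Nat.strong_induction_on with
    | _ i ih =>
      intro hi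
      rcases Nat.lt_or_ge (m + p) i with h1 | h1
      · have h2 := ih (i - p) (by omega) (by omega)
        rwa [← h.periodic _ (by omega), Nat.sub_add_cancel (by omega)] at h2
      · have := hcon i hi h1
        omega
  obtain ⟨i, hi, hne⟩ := h.not_simple m
  exact hne (hz i hi)

end IsNonSimpleParry

/-! ### The fixed point -/

theorem subst_append (t : ℕ → ℕ) (m p : ℕ) (v w : List ℕ) :
    subst t m p (v ++ w) = subst t m p v ++ subst t m p w := List.flatMap_append

theorem subst_singleton (t : ℕ → ℕ) (m p a : ℕ) :
    subst t m p [a] = List.replicate (t (a + 1)) 0 ++ [nxt m p a] := by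
  simp [subst, substLetter, nxt]

theorem substIter_append (t : ℕ → ℕ) (m p n : ℕ) (v w : List ℕ) :
    substIter t m p n (v ++ w) = substIter t m p n v ++ substIter t m p n w := by
  induction n generalizing v w with
  | zero => rfl
  | succ n ih =>
    simp only [substIter, Function.iterate_succ_apply] at ih ⊢
    rw [subst_append, ih]

theorem length_substIter_replicate (t : ℕ → ℕ) (m p n k a : ℕ) :
    (substIter t m p n (List.replicate k a)).length = k * (substIter t m p n [a]).length := by
  induction k with
  | zero =>
    have : substIter t m p n [] = [] := by
      simp only [substIter]
      exact Function.iterate_fixed rfl n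
    simp [this]
  | succ k ih =>
    rw [List.replicate_succ, ← List.singleton_append, substIter_append, List.length_append, ih]
    ring

theorem length_substIter (t : ℕ → ℕ) (m p n a : ℕ) :
    (substIter t m p n [a]).length = blockLen t m p n a := by
  induction n generalizing a with
  | zero => rfl
  | succ n ih =>
    have : substIter t m p (n + 1) [a] = substIter t m p n (subst t m p [a]) := rfl
    rw [this, subst_singleton, substIter_append, List.length_append, length_substIter_replicate,
      ih, ih]
    rfl

theorem length_substIter_zeroBlockM (t : ℕ → ℕ) (m p n : ℕ) :
    (substIter t m p n (zeroBlockM t m p)).length = zeroBlockLen t m p n := by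
  rw [zeroBlockM, substIter_append, List.length_append, length_substIter_replicate,
    length_substIter, length_substIter, zeroBlockLen]

theorem length_zWord (t : ℕ → ℕ) (m p z n : ℕ) :
    (zWord t m p z n).length = zWordLen t m p z n := by
  unfold zWord zWordLen
  split_ifs
  · rfl
  · induction n / m with
    | zero => rfl
    | succ k ih =>
      rw [List.range_succ, List.flatMap_append, List.length_append, ih, Finset.sum_range_succ]
      simp [length_substIter_zeroBlockM]
  · exact length_substIter_zeroBlockM ..

/-- The prefix of length `x` of `u`. -/
def prefixOf (u : ℕ → ℕ) (x : ℕ) : List ℕ := (List.range x).map u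

theorem subst_prefix {t : ℕ → ℕ} {m p : ℕ} {v w : List ℕ} (h : v <+: w) :
    subst t m p v <+: subst t m p w := by
  obtain ⟨s, rfl⟩ := h
  rw [subst_append]
  exact List.prefix_append _ _

theorem substIter_succ' (t : ℕ → ℕ) (m p n : ℕ) (w : List ℕ) :
    substIter t m p (n + 1) w = subst t m p (substIter t m p n w) :=
  Function.iterate_succ_apply' _ _ _

theorem substIter_zero_prefix_succ {t : ℕ → ℕ} (ht : 1 ≤ t 1) (m p n : ℕ) :
    substIter t m p n [0] <+: substIter t m p (n + 1) [0] := by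
  induction n with
  | zero =>
    rw [substIter_succ']
    change [0] <+: subst t m p [0]
    rw [subst_singleton, zero_add]
    obtain ⟨k, hk⟩ := Nat.exists_eq_add_of_le' ht
    rw [hk, List.replicate_succ]
    exact ⟨_, rfl⟩
  | succ n ih =>
    rw [substIter_succ', substIter_succ' t m p (n + 1)]
    exact subst_prefix ih

theorem substIter_zero_prefix {t : ℕ → ℕ} (ht : 1 ≤ t 1) (m p : ℕ) {k n : ℕ} (h : k ≤ n) :
    substIter t m p k [0] <+: substIter t m p n [0] := by
  induction n, h using Nat.le_induction with
  | base => exact List.prefix_rfl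
  | succ n _ ih => exact ih.trans (substIter_zero_prefix_succ ht m p n)

theorem lt_length_substIter_zero {t : ℕ → ℕ} (ht : 1 ≤ t 1) (m p n : ℕ) :
    n < (substIter t m p n [0]).length := by
  rw [length_substIter]
  induction n with
  | zero => simp [blockLen]
  | succ n ih =>
    have := blockLen_pos t m p n (nxt m p 0)
    simp only [blockLen, zero_add]
    nlinarith

theorem substIter_zero_getElem {t : ℕ → ℕ} (ht : 1 ≤ t 1) (m p : ℕ) {n i : ℕ}
    (h : i < (substIter t m p n [0]).length) :
    (substIter t m p n [0])[i] = fixedPoint t m p i := by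
  have hi := lt_length_substIter_zero ht m p i
  have h1 : fixedPoint t m p i = (substIter t m p i [0])[i] := by
    rw [fixedPoint, List.getD_eq_getElem _ _ hi]
  rw [h1]
  rcases le_total i n with hin | hin
  · exact ((substIter_zero_prefix ht m p hin).getElem hi).symm
  · exact (substIter_zero_prefix ht m p hin).getElem h

theorem prefixOf_prefix {t : ℕ → ℕ} (ht : 1 ≤ t 1) (m p x : ℕ) :
    prefixOf (fixedPoint t m p) x <+: substIter t m p x [0] := by
  have hx := lt_length_substIter_zero ht m p x
  rw [List.prefix_iff_eq_take]
  refine List.ext_getElem (by simp [prefixOf, hx.le]) fun i h1 h2 => ?_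
  rw [List.getElem_take, substIter_zero_getElem ht]
  simp [prefixOf]

theorem subst_prefixOf {t : ℕ → ℕ} (ht : 1 ≤ t 1) (m p x : ℕ) {i : ℕ}
    (hi : i < (subst t m p (prefixOf (fixedPoint t m p) x)).length) :
    (subst t m p (prefixOf (fixedPoint t m p) x))[i] = fixedPoint t m p i := by
  have h := subst_prefix (t := t) (m := m) (p := p) (prefixOf_prefix ht m p x)
  rw [h.getElem hi]
  have h1 := h.length_le
  simp only [← substIter_succ'] at h1 ⊢
  exact substIter_zero_getElem ht m p _

/-- The position at which the image of the letter at position `x` starts. -/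
def imagePos (t : ℕ → ℕ) (m p : ℕ) (u : ℕ → ℕ) (x : ℕ) : ℕ :=
  (subst t m p (prefixOf u x)).length

theorem fixedPoint_imagePos {t : ℕ → ℕ} (ht : 1 ≤ t 1) (m p x : ℕ) {j : ℕ}
    (hj : j < (subst t m p [fixedPoint t m p x]).length) :
    fixedPoint t m p (imagePos t m p (fixedPoint t m p) x + j) =
      (subst t m p [fixedPoint t m p x])[j] := by
  have h1 : prefixOf (fixedPoint t m p) (x + 1) =
      prefixOf (fixedPoint t m p) x ++ [fixedPoint t m p x] := by
    simp [prefixOf, List.range_succ]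
  have h2 := subst_prefixOf ht m p (x + 1) (i := imagePos t m p (fixedPoint t m p) x + j)
    (by rw [h1, subst_append, List.length_append, imagePos]; omega)
  simp only [h1, subst_append] at h2
  rw [← h2, List.getElem_append_right (by simp [imagePos])]
  simp [imagePos]

theorem IsNonSimpleParry.parrySystem {β : ℝ} {m p : ℕ} (h : IsNonSimpleParry β m p)
    (ht : 3 ≤ renyiDigit β 1) : ParrySystem (renyiDigit β) m p (uBeta β m p)
      (imagePos (renyiDigit β) m p (uBeta β m p)) β (renyiRem β) where
  one_lt := h.one_lt
  m_pos := h.m_pos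
  p_pos := h.p_pos
  three_le := ht
  digit_ne := h.digit_ne
  exists_digit_pos := h.exists_digit_pos
  rem_zero := rfl
  rem_pos := h.renyiRem_pos
  rem_lt a ha := by
    obtain ⟨b, rfl⟩ := Nat.exists_eq_add_of_le' ha
    exact renyiRem_succ_lt β b
  rem_succ := mul_renyiRem h.one_lt
  rem_period := h.renyiRem_period
  u_zero := rfl
  f_zero := rfl
  f_succ x := by
    simp [imagePos, prefixOf, List.range_succ, subst_append, subst_singleton, add_assoc]
  u_zeros x j hj := by
    have := fixedPoint_imagePos (show 1 ≤ renyiDigit β 1 by omega) m p x (j := j)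
      (by rw [subst_singleton]; simp only [List.length_append, List.length_replicate,
        List.length_singleton]; exact Nat.lt_succ_of_lt hj)
    rw [uBeta, this]
    simp only [subst_singleton]
    rw [List.getElem_append_left (by rw [List.length_replicate]; exact hj)]
    simp
  u_last x := by
    have := fixedPoint_imagePos (show 1 ≤ renyiDigit β 1 by omega) m p x
      (j := renyiDigit β (fixedPoint (renyiDigit β) m p x + 1))
      (by rw [subst_singleton]; simp)
    rw [uBeta, this]
    simp only [subst_singleton]
    rw [List.getElem_append_right (by simp)]
    simp

/-! ### Factors and powers -/

theorem isFactor_iff {u : ℕ → ℕ} {w : List ℕ} :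
    IsFactor u w ↔ ∃ i, ∀ j (h : j < w.length), w[j] = u (i + j) := by
  refine exists_congr fun i => ⟨fun h j hj => ?_, fun h => ?_⟩
  · conv_lhs => rw [List.getElem_of_eq h]
    simp
  · refine List.ext_getElem (by simp) fun j h1 h2 => ?_
    rw [h j h1]
    simp

theorem getElem?_flatten_replicate {w : List ℕ} {k i : ℕ} (h : i < k * w.length) :
    (List.replicate k w).flatten[i]? = w[i % w.length]? := by
  induction k generalizing i with
  | zero => simp at h
  | succ k ih =>
    rw [List.replicate_succ, List.flatten_cons]
    rw [add_mul, one_mul] at h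
    rcases Nat.lt_or_ge i w.length with hi | hi
    · rw [List.getElem?_append_left hi, Nat.mod_eq_of_lt hi]
    · rw [List.getElem?_append_right hi, ih (by omega), Nat.mod_eq_sub_mod hi]

theorem IsPowerOf.getElem?_eq {v w : List ℕ} (h : IsPowerOf v w) {i : ℕ} (hi : i < v.length) :
    v[i]? = w[i % w.length]? := by
  obtain ⟨k, hk⟩ := h
  have hlen := hk.length_le
  simp only [List.length_flatten, List.map_replicate, List.sum_replicate, smul_eq_mul] at hlen
  rw [← getElem?_flatten_replicate (k := k) (by omega)]
  obtain ⟨s, hs⟩ := hk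
  rw [← hs, List.getElem?_append_left hi]

/-- A factor that is a power of `w` is a repetition with period `|w|`. -/
theorem exists_match_of_isPowerOf {u : ℕ → ℕ} {v w : List ℕ} (hv : IsFactor u v)
    (hvw : IsPowerOf v w) : ∃ x, ∀ j < v.length - w.length, u (x + j) = u (x + w.length + j) := by
  obtain ⟨x, hx⟩ := isFactor_iff.1 hv
  refine ⟨x, fun j hj => ?_⟩
  have h1 := hvw.getElem?_eq (i := j) (by omega)
  have h2 := hvw.getElem?_eq (i := w.length + j) (by omega)
  rw [Nat.add_mod_left, ← h1, List.getElem?_eq_getElem (by omega),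
    List.getElem?_eq_getElem (by omega), Option.some_inj, hx, hx] at h2
  rw [add_assoc, h2]

theorem eq_of_match {u : ℕ → ℕ} {x q B : ℕ} (hq : 1 ≤ q)
    (hB : ∀ j < B, u (x + j) = u (x + q + j)) (i : ℕ) (hi : i < B + q) :
    u (x + i) = u (x + i % q) := by
  induction i using Nat.strong_induction_on with
  | _ i ih =>
    rcases Nat.lt_or_ge i q with h | h
    · rw [Nat.mod_eq_of_lt h]
    · have h1 := hB (i - q) (by omega)
      rw [Nat.mod_eq_sub_mod h, ← ih (i - q) (by omega) (by omega), h1]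
      congr 1; omega

/-- A repetition with period `q` gives a factor of length `q` and a power of it. -/
theorem exists_isPowerOf_of_match {u : ℕ → ℕ} {x q B : ℕ} (hq : 1 ≤ q)
    (hB : ∀ j < B, u (x + j) = u (x + q + j)) : ∃ v w : List ℕ, w.length = q ∧
      v.length = B + q ∧ IsFactor u w ∧ IsFactor u v ∧ IsPowerOf v w := by
  refine ⟨(List.range (B + q)).map fun j => u (x + j), (List.range q).map fun j => u (x + j),
    by simp, by simp, ⟨x, by simp⟩, ⟨x, by simp⟩, B + q, ?_⟩
  set w := (List.range q).map fun j => u (x + j) with hw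
  have hlen : w.length = q := by simp [hw]
  have hle : B + q ≤ (B + q) * w.length := by rw [hlen]; exact Nat.le_mul_of_pos_right _ hq
  rw [List.prefix_iff_eq_take]
  refine List.ext_getElem? fun i => ?_
  simp only [List.length_map, List.length_range]
  rcases Nat.lt_or_ge i (B + q) with hi | hi
  · rw [List.getElem?_take_of_lt hi, getElem?_flatten_replicate (by omega), hlen,
      List.getElem?_map, List.getElem?_range hi, hw, List.getElem?_map,
      List.getElem?_range (Nat.mod_lt _ hq)]
    simp only [Option.map_some]
    rw [eq_of_match hq hB i hi]
  · rw [List.getElem?_eq_none (by simpa using hi), List.getElem?_eq_none (by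
      rw [List.length_take]; omega)]

theorem le_index_of_match {u : ℕ → ℕ} {x q B : ℕ} (hq : 1 ≤ q)
    (hB : ∀ j < B, u (x + j) = u (x + q + j)) : ∃ w : List ℕ, w.length = q ∧ IsFactor u w ∧
      ((((B + q : ℕ) : ℝ) / q : ℝ) : EReal) ≤ index u w := by
  obtain ⟨v, w, h1, h2, h3, h4, h5⟩ := exists_isPowerOf_of_match hq hB
  exact ⟨w, h1, h3, le_sSup ⟨v, h4, h5, by rw [h1, h2]⟩⟩

/-! ### From repetitions to critical exponents -/

namespace ParrySystem

variable {t : ℕ → ℕ} {m p : ℕ} {u f : ℕ → ℕ} {β : ℝ} {r : ℕ → ℝ} {z : ℕ}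

theorem maxExponent_eq (n : ℕ) : maxExponent t m p z n =
    (t 1 * blockLen t m p n 0 + blockLen t m p n 1 + zWordLen t m p z n - 1) /
      blockLen t m p n 0 := by
  have : (blockLen t m p n 0 : ℝ) ≠ 0 := by exact_mod_cast (blockLen_pos t m p n 0).ne'
  unfold maxExponent
  field_simp
  ring

theorem maxExponent_zero (hm : 1 ≤ m) : maxExponent t m p z 0 = t 1 := by
  have : zWordLen t m p z 0 = 0 := if_pos hm
  simp [maxExponent, this, blockLen]

theorem digit_le_maxExponent (n : ℕ) : (t 1 : ℝ) ≤ maxExponent t m p z n := by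
  unfold maxExponent
  have h1 : (1 : ℝ) ≤ blockLen t m p n 1 := by exact_mod_cast blockLen_pos t m p n 1
  have h2 : 0 ≤ ((zWordLen t m p z n : ℝ) + blockLen t m p n 1 - 1) / blockLen t m p n 0 :=
    div_nonneg (by linarith [Nat.cast_nonneg (α := ℝ) (zWordLen t m p z n)]) (Nat.cast_nonneg _)
  linarith

/-- The assumption `hc` makes every short repetition harmless: its exponent is below `4`, or below
`3` if `p ∤ z`, hence at most `t 1`, the value of `maxExponent` at `0`. The bound on `|w|` lets long
`w` force large `n`. -/
theorem exponent_le (S : ParrySystem t m p u f β r) (hz : IsLeftLetter t m p u z)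
    (hc : 4 ≤ t 1 ∨ (t 1 = 3 ∧ ¬ p ∣ z)) {v w : List ℕ} (hw : w ≠ []) (hv : IsFactor u v)
    (hvw : IsPowerOf v w) : (v.length : ℝ) / w.length ≤ t 1 ∨
      ∃ n, w.length ≤ t 1 * blockLen t m p n 0 ∧
        (v.length : ℝ) / w.length ≤ maxExponent t m p z n := by
  have ht := S.three_le
  obtain ⟨x, hx⟩ := exists_match_of_isPowerOf hv hvw
  have hw0 : 1 ≤ w.length := List.length_pos_iff.2 hw
  have hw1 : (0 : ℝ) < w.length := by exact_mod_cast hw0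
  rcases S.repetition_bound hz hw0 hx with ⟨n, q', h1, h2, h3, h4⟩ | ⟨h1, h2⟩
  · right
    refine ⟨n, by rw [h3]; exact Nat.mul_le_mul_right _ h2, ?_⟩
    rw [maxExponent_eq]
    have hU : (0 : ℝ) < blockLen t m p n 0 := by exact_mod_cast blockLen_pos t m p n 0
    have h5 : blockLen t m p n 0 ≤ w.length := by
      rw [h3]; exact Nat.le_mul_of_pos_left _ h1
    have h6 : v.length + 1 ≤
        t 1 * blockLen t m p n 0 + blockLen t m p n 1 + zWordLen t m p z n := by omega
    have h7 : (v.length : ℝ) + 1 ≤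
        t 1 * blockLen t m p n 0 + blockLen t m p n 1 + zWordLen t m p z n := by exact_mod_cast h6
    apply div_le_div₀ <;> first | exact_mod_cast h5 | linarith [Nat.cast_nonneg (α := ℝ) v.length]
  · left
    rw [div_le_iff₀ hw1]
    have : v.length ≤ t 1 * w.length := by
      rcases hc with hc | ⟨hc, hpz⟩
      · nlinarith [Nat.mul_le_mul_right w.length hc,
          (show v.length ≤ 4 * w.length by omega)]
      · have := h2 hpz
        rw [hc]; omega
    exact_mod_cast this

theorem exists_maxExponent_le_index (S : ParrySystem t m p u f β r)
    (hz : IsLeftLetter t m p u z) (n : ℕ) : ∃ w : List ℕ, w.length = blockLen t m p n 0 ∧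
      IsFactor u w ∧ (maxExponent t m p z n : EReal) ≤ index u w := by
  obtain ⟨x, B, h1, h2⟩ := S.exists_repetition hz n
  obtain ⟨w, h3, h4, h5⟩ := le_index_of_match (blockLen_pos t m p n 0) h1
  refine ⟨w, h3, h4, le_trans (le_of_eq ?_) h5⟩
  congr 1
  rw [maxExponent_eq]
  congr 1
  have : ((B : ℝ) + blockLen t m p n 0 + 1) =
      t 1 * blockLen t m p n 0 + blockLen t m p n 1 + zWordLen t m p z n := by exact_mod_cast h2
  push_cast
  linarith

theorem criticalExponent_eq (S : ParrySystem t m p u f β r) (hz : IsLeftLetter t m p u z)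
    (hc : 4 ≤ t 1 ∨ (t 1 = 3 ∧ ¬ p ∣ z)) :
    criticalExponent u = ⨆ n, (maxExponent t m p z n : EReal) := by
  apply le_antisymm
  · refine sSup_le ?_
    rintro _ ⟨w, hw, -, rfl⟩
    refine sSup_le ?_
    rintro _ ⟨v, hv, hvw, rfl⟩
    rcases S.exponent_le hz hc hw hv hvw with h | ⟨n, -, h⟩
    · refine le_trans ?_ (le_iSup _ 0)
      rw [maxExponent_zero S.m_pos]
      exact_mod_cast h
    · refine le_trans ?_ (le_iSup _ n)
      exact_mod_cast h
  · refine iSup_le fun n => ?_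
    obtain ⟨w, h1, h2, h3⟩ := S.exists_maxExponent_le_index hz n
    refine h3.trans (le_sSup ⟨w, ?_, h2, rfl⟩)
    have := blockLen_pos t m p n 0
    rintro rfl
    simp at h1
    omega

theorem ultimateCriticalExponent_eq (S : ParrySystem t m p u f β r)
    (hz : IsLeftLetter t m p u z) (hc : 4 ≤ t 1 ∨ (t 1 = 3 ∧ ¬ p ∣ z)) {L : ℝ}
    (hL : Tendsto (maxExponent t m p z) atTop (𝓝 L)) : ultimateCriticalExponent u = L := by
  apply le_antisymm
  · rw [← EReal.le_of_forall_lt_iff_le]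
    intro c hcL
    rw [EReal.coe_lt_coe_iff] at hcL
    have htL : (t 1 : ℝ) ≤ L := ge_of_tendsto' hL digit_le_maxExponent
    obtain ⟨N, hN⟩ := eventually_atTop.1 (hL.eventually_lt_const hcL)
    -- A period longer than `t 1 * |φ^N(0)|` can only arise at a level `n ≥ N`; the short
    -- repetitions stay below `t 1 ≤ L`.
    refine limsup_le_of_le (by isBoundedDefault) ?_
    filter_upwards [eventually_gt_atTop (t 1 * blockLen t m p N 0)] with q hq
    refine sSup_le ?_
    rintro _ ⟨w, hw, -, rfl⟩
    refine sSup_le ?_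
    rintro _ ⟨v, hv, hvw, rfl⟩
    rw [EReal.coe_le_coe_iff]
    have hw0 : w ≠ [] := by
      rintro rfl
      simp at hw
      omega
    rcases S.exponent_le hz hc hw0 hv hvw with h | ⟨n, h1, h⟩
    · linarith
    · have hn : N ≤ n := by
        by_contra! hlt
        have := Nat.mul_le_mul_left (t 1) (S.blockLen_zero_mono hlt.le)
        omega
      linarith [hN n hn]
  · have h1 : Tendsto (fun n => (maxExponent t m p z n : EReal)) atTop (𝓝 (L : EReal)) :=
      (continuous_coe_real_ereal.tendsto L).comp hL
    have h2 : Tendsto (fun n => blockLen t m p n 0) atTop atTop :=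
      tendsto_atTop_mono (fun n => (S.lt_blockLen_zero n).le) tendsto_id
    rw [← h1.limsup_eq]
    calc limsup (fun n => (maxExponent t m p z n : EReal)) atTop
        ≤ limsup (fun n => indexOfLength u (blockLen t m p n 0)) atTop := by
          refine limsup_le_limsup (Eventually.of_forall fun n => ?_)
          obtain ⟨w, h3, h4, h5⟩ := S.exists_maxExponent_le_index hz n
          exact h5.trans (le_sSup ⟨w, h3, h4, rfl⟩)
      _ = limsup (indexOfLength u) (map (fun n => blockLen t m p n 0) atTop) := rfl
      _ ≤ limsup (indexOfLength u) atTop := limsup_le_limsup_of_le h2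

theorem leftExt_zeroBlockM (S : ParrySystem t m p u f β r) (hz : IsLeftLetter t m p u z) :
    leftExt u (zeroBlockM t m p) = {0, z} := by
  have hm1 := S.m_pos
  have hp1 := S.p_pos
  have hmem : ∀ a, a ∈ leftExt u (zeroBlockM t m p) ↔ ∃ i, u i = a ∧
      (∀ j < tMin t m p, u (i + 1 + j) = 0) ∧ u (i + 1 + tMin t m p) = m := by
    intro a
    rw [leftExt, Set.mem_ofPred_eq, isFactor_iff]
    refine exists_congr fun i => ⟨fun h => ⟨?_, fun j hj => ?_, ?_⟩, fun ⟨h1, h2, h3⟩ j hj => ?_⟩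
    · exact (h 0 (by simp)).symm
    · have := h (j + 1) (by simp [zeroBlockM]; omega)
      simp only [List.getElem_cons_succ, zeroBlockM] at this
      rw [List.getElem_append_left (by simpa using hj), List.getElem_replicate] at this
      rw [this]; congr 1; omega
    · have := h (tMin t m p + 1) (by simp [zeroBlockM])
      simp only [List.getElem_cons_succ, zeroBlockM] at this
      rw [List.getElem_append_right (by simp)] at this
      simp only [List.getElem_singleton] at this
      exact (congrArg u (by omega)).trans this.symm
    · rcases Nat.eq_zero_or_pos j with rfl | hj0
      · exact h1.symm
      · obtain ⟨k, rfl⟩ := Nat.exists_eq_add_of_le' hj0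
        simp only [List.getElem_cons_succ, zeroBlockM]
        simp only [zeroBlockM, List.length_cons, List.length_append, List.length_replicate,
          List.length_nil] at hj
        rcases Nat.lt_or_ge k (tMin t m p) with hk | hk
        · rw [List.getElem_append_left (by simpa using hk), List.getElem_replicate]
          exact (h2 k hk).symm.trans (congrArg u (by omega))
        · rw [List.getElem_append_right (by simpa using hk)]
          simp only [List.getElem_singleton]
          exact h3.symm.trans (congrArg u (by omega))
  have hcov : ∀ b, b < m + p → nxt m p b = m → ∃ i, (∀ j < tMin t m p, u (i + 1 + j) = 0) ∧
      u (i + 1 + tMin t m p) = m ∧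
      ((t (b + 1) = tMin t m p ∧ u i = z) ∨ (t (b + 1) ≠ tMin t m p ∧ u i = 0)) := by
    intro b hb hbm
    obtain ⟨x, -, hx, -⟩ := S.u_iterate_one hb
    obtain ⟨i, -, h2, h3, h4⟩ := S.exists_before_zeroBlock hz (x := x) (by rw [hx]; exact hbm)
    rw [hx] at h4
    exact ⟨i, h2, h3, h4⟩
  have h1 : nxt m p (m - 1) = nxt m p (m + p - 1) := by
    unfold nxt; rw [if_pos (by omega), if_neg (by omega)]; omega
  -- Both `m - 1` and `m + p - 1` occur in `u`; exactly one has the smaller digit, so one image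
  -- yields the left extension `z` and the other `0`.
  obtain ⟨h2, h3⟩ := S.tMin_eq_iff (a := m - 1) (b := m + p - 1) (by omega) (by omega) h1 (by omega)
  obtain ⟨i, hi1, hi2, hi3⟩ := hcov (m - 1) (by omega) h2
  obtain ⟨k, hk1, hk2, hk3⟩ := hcov (m + p - 1) (by omega) (h1 ▸ h2)
  ext a
  rw [hmem, Set.mem_insert_iff, Set.mem_singleton_iff]
  constructor
  · rintro ⟨j, rfl, h5, h6⟩
    obtain ⟨x, -, h7, h8⟩ := S.exists_of_ne_zero (y := j + 1 + tMin t m p) (by omega)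
    obtain ⟨y, h9, -, -, h10⟩ := S.exists_before_zeroBlock hz (x := x) (by rw [← h8, h6])
    obtain rfl : y = j := by omega
    tauto
  · have hi4 : ∀ a, u i = a → ∃ i, u i = a ∧ (∀ j < tMin t m p, u (i + 1 + j) = 0) ∧
        u (i + 1 + tMin t m p) = m := fun a h => ⟨i, h, hi1, hi2⟩
    have hk4 : ∀ a, u k = a → ∃ i, u i = a ∧ (∀ j < tMin t m p, u (i + 1 + j) = 0) ∧
        u (i + 1 + tMin t m p) = m := fun a h => ⟨k, h, hk1, hk2⟩
    rintro (rfl | rfl)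
    · rcases hi3 with ⟨h5, h6⟩ | ⟨h5, h6⟩
      · exact hk4 0 (by tauto)
      · exact hi4 0 h6
    · rcases hi3 with ⟨h5, h6⟩ | ⟨h5, h6⟩
      · exact hi4 _ h6
      · exact hk4 _ (by tauto)

end ParrySystem

end ParryWord

theorem mainTheorem1 (β : ℝ) (m p : ℕ) (hβ : ParryWord.IsNonSimpleParry β m p)
    (ht : 3 ≤ ParryWord.renyiDigit β 1) :
    ∃ z : ℕ, z ≠ 0 ∧
      ParryWord.leftExt (ParryWord.uBeta β m p)
        (ParryWord.zeroBlockM (ParryWord.renyiDigit β) m p) = {0, z} ∧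
      ((4 ≤ ParryWord.renyiDigit β 1 ∨ (ParryWord.renyiDigit β 1 = 3 ∧ ¬ p ∣ z)) →
        ParryWord.criticalExponent (ParryWord.uBeta β m p) =
          (⨆ n : ℕ, (((ParryWord.renyiDigit β 1 : ℝ) +
            (((ParryWord.zWord (ParryWord.renyiDigit β) m p z n).length : ℝ) +
              ((ParryWord.substIter (ParryWord.renyiDigit β) m p n [1]).length : ℝ) - 1) /
              ((ParryWord.substIter (ParryWord.renyiDigit β) m p n [0]).length : ℝ) : ℝ) :
              EReal)) ∧
        (p ∣ z → ParryWord.ultimateCriticalExponent (ParryWord.uBeta β m p) =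
          ((β + 1 / (β ^ m - 1) *
            ((ParryWord.tMin (ParryWord.renyiDigit β) m p : ℝ) + ParryWord.gap β m) : ℝ) :
            EReal)) ∧
        (¬ p ∣ z → ParryWord.ultimateCriticalExponent (ParryWord.uBeta β m p) =
          ((β + 1 / β ^ m *
            ((ParryWord.tMin (ParryWord.renyiDigit β) m p : ℝ) + ParryWord.gap β m) : ℝ) :
            EReal))) := by
  have S := hβ.parrySystem ht
  obtain ⟨z, hz⟩ := S.exists_isLeftLetter
  have hexp : ∀ n, ParryWord.maxExponent (ParryWord.renyiDigit β) m p z n =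
      (ParryWord.renyiDigit β 1 : ℝ) +
        (((ParryWord.zWord (ParryWord.renyiDigit β) m p z n).length : ℝ) +
          ((ParryWord.substIter (ParryWord.renyiDigit β) m p n [1]).length : ℝ) - 1) /
          ((ParryWord.substIter (ParryWord.renyiDigit β) m p n [0]).length : ℝ) := fun n => by
    rw [ParryWord.length_zWord, ParryWord.length_substIter, ParryWord.length_substIter]; rfl
  refine ⟨z, hz.ne_zero, S.leftExt_zeroBlockM hz, fun hc => ⟨?_, fun hpz => ?_, fun hpz => ?_⟩⟩
  · rw [S.criticalExponent_eq hz hc]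
    simp only [hexp]
  · rw [ParryWord.gap_eq_renyiRem hβ.one_lt]
    exact S.ultimateCriticalExponent_eq hz hc (S.tendsto_maxExponent_of_dvd hz.ne_zero hz.lt hpz)
  · rw [ParryWord.gap_eq_renyiRem hβ.one_lt]
    exact S.ultimateCriticalExponent_eq hz hc (S.tendsto_maxExponent_of_not_dvd hpz)
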